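/- Let $n\ge 2$, let $G=\mathcal F_n$ be the free group on $n$ generators with unit $e$, let $\mathsf h=\ell^2(G)$, and for $g\in G$ let $L_g,R_g$ be the unitary operators on $\mathsf h$ given by $(L_gu)(h)=u(g^{-1}h)$ and $(R_gu)(h)=u(hg^{-1})$ (left and right convolution by the indicator function $1_g$). Let $\mathcal L_G$ and $\mathcal R_G$ be the von Neumann algebras generated by $\{L_g: g\in G\}$ and $\{R_g: g\in G\}$, respectively, and write $S'$ for the commutant of $S\subseteq\mathcal B(\mathsf h)$. Let $(c_g)_{g\in G}$ be non-negative real weights with $\sum_{g\in G}c_g=1$ whose support $\{g: c_g\neq 0\}$ generates $G$ as a group. (Such weights exist, even with $c_g>0$ for all $g\in G$.) Then for every $x\in\mathcal B(\mathsf h)$ the series $$\mathcal L(x)=\sum_{g\in G}c_g\,L_g^*\,x\,L_g-x$$ converges in norm; $\mathcal L$ is a bounded operator on $\mathcal B(\mathsf h)$, it has the Gorini–Kossakowski–Sudarshan–Lindblad form with Hamiltonian $0$ and Lindblad operators $\sqrt{c_g}\,L_g$ ($g\in G$), and it is the generator of exactly one uniformly continuous quantum Markov semigroup $\mathcal T=(\mathcal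 T_t)_{t\ge0}$ on $\mathcal B(\mathsf h)$ (a semigroup of completely positive, identity preserving, normal maps with $\mathcal T_0=\mathrm{id}$, $\|\mathcal T_t-\mathrm{id}\|\to0$ as $t\to0^+$). Its decoherence-free subalgebra $$\mathcal N(\mathcal T)=\{x\in\mathcal B(\mathsf h): \mathcal T_t(x^*x)=\mathcal T_t(x)^*\mathcal T_t(x),\ \mathcal T_t(xx^*)=\mathcal T_t(x)\mathcal T_t(x)^*\ \ \forall t\ge0\}$$ satisfies $$\mathcal N(\mathcal T)=\{L_g: g\in G\}'=\mathcal L_G'=\mathcal R_G .$$ Moreover $\mathcal N(\mathcal T)=\mathcal R_G$ is a type $II_1$ factor (its center is $\mathbb C 1$, it has no minimal projections, and its identity is a finite projection); in particular it is not atomic, i.e. it is not true that each of its non-zero projections majorizes a minimal projection. Finally, $\mathcal T$ has no faithful normal invariant state. -/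

import Mathlib

open Set Filter Topology
open scoped NNReal ENNReal ComplexOrder

noncomputable section

namespace QMS

/-! ### Von Neumann algebras on a Hilbert space -/

section VonNeumann

variable {H : Type*} [NormedAddCommGroup H] [InnerProductSpace ℂ H] [CompleteSpace H]

/-- The von Neumann algebra generated by a set `S` of bounded operators: the double commutant of
`S ∪ S*`. It is the smallest von Neumann algebra containing `S`, see `subset_generatedVN` and
`generatedVN_le`. -/
def generatedVN (S : Set (H →L[ℂ] H)) : VonNeumannAlgebra H where
  toStarSubalgebra := StarSubalgebra.centralizer ℂ (StarSubalgebra.centralizer ℂ S : Set _)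
  centralizer_centralizer' := by
    change Set.centralizer (Set.centralizer (SetLike.coe
      (StarSubalgebra.centralizer ℂ (StarSubalgebra.centralizer ℂ S : Set (H →L[ℂ] H))))) =
      SetLike.coe
        (StarSubalgebra.centralizer ℂ (StarSubalgebra.centralizer ℂ S : Set (H →L[ℂ] H)))
    rw [StarSubalgebra.coe_centralizer_centralizer, Set.centralizer_centralizer_centralizer]

theorem coe_generatedVN (S : Set (H →L[ℂ] H)) :
    (generatedVN S : Set (H →L[ℂ] H)) = Set.centralizer (Set.centralizer (S ∪ star S)) :=
  StarSubalgebra.coe_centralizer_centralizer ℂ S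

theorem subset_generatedVN (S : Set (H →L[ℂ] H)) : S ⊆ (generatedVN S : Set (H →L[ℂ] H)) := by
  rw [coe_generatedVN]
  exact Set.subset_union_left.trans Set.subset_centralizer_centralizer

theorem generatedVN_le {S : Set (H →L[ℂ] H)} {M : VonNeumannAlgebra H}
    (h : S ⊆ (M : Set (H →L[ℂ] H))) :
    (generatedVN S : Set (H →L[ℂ] H)) ⊆ (M : Set (H →L[ℂ] H)) := by
  rw [coe_generatedVN, ← VonNeumannAlgebra.centralizer_centralizer M]
  refine Set.centralizer_subset (Set.centralizer_subset (Set.union_subset h ?_))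
  intro x hx
  have : star x ∈ M := h hx
  simpa using star_mem this

/-- `M` is a factor: its center consists of the scalar multiples of the identity. -/
def IsFactor (M : VonNeumannAlgebra H) : Prop :=
  {x : H →L[ℂ] H | x ∈ M ∧ ∀ y ∈ M, x * y = y * x} = Set.range (fun z : ℂ => z • (1 : H →L[ℂ] H))

/-- `p` is a (non-zero) minimal projection of `M`. -/
def IsMinimalProj (M : VonNeumannAlgebra H) (p : H →L[ℂ] H) : Prop :=
  p ∈ M ∧ IsStarProjection p ∧ p ≠ 0 ∧
    ∀ q ∈ M, IsStarProjection q → q ≤ p → q = 0 ∨ q = p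

/-- `p` is a finite projection of `M`: it is not equivalent in `M` to a proper subprojection. -/
def IsFiniteProj (M : VonNeumannAlgebra H) (p : H →L[ℂ] H) : Prop :=
  p ∈ M ∧ IsStarProjection p ∧ ∀ u ∈ M, star u * u = p → u * star u ≤ p → u * star u = p

/-- `M` is atomic: every non-zero projection of `M` majorizes a minimal projection of `M`. -/
def IsAtomic (M : VonNeumannAlgebra H) : Prop :=
  ∀ p ∈ M, IsStarProjection p → p ≠ 0 → ∃ q, IsMinimalProj M q ∧ q ≤ p

/-- `M` is a type II factor. -/
def IsTypeIIFactor (M : VonNeumannAlgebra H) : Prop :=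
  IsFactor M ∧ (∀ p, ¬ IsMinimalProj M p) ∧ ∃ p, p ≠ 0 ∧ IsFiniteProj M p

/-- `M` is a type II₁ factor: a type II factor whose identity is finite. -/
def IsTypeII₁Factor (M : VonNeumannAlgebra H) : Prop :=
  IsTypeIIFactor M ∧ IsFiniteProj M 1

end VonNeumann

/-! ### Uniformly continuous quantum Markov semigroups on `B(H)` -/

section Semigroups

variable {H : Type*} [NormedAddCommGroup H] [InnerProductSpace ℂ H] [CompleteSpace H]

/-- Normality (order continuity): suprema of bounded increasing nets are preserved. -/
def IsNormalMap {A B : Type*} [Preorder A] [Preorder B] (f : A → B) : Prop :=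
  ∀ (D : Set A) (s : A), D.Nonempty → DirectedOn (· ≤ ·) D → IsLUB D s → IsLUB (f '' D) (f s)

/-- A uniformly continuous quantum Markov semigroup on `B(H)`: a one-parameter semigroup of
completely positive, identity preserving, normal maps with `‖T_t - id‖ → 0` as `t → 0+`
(which subsumes weak* continuity in `t`). -/
structure IsUniformlyContinuousQMS (T : ℝ≥0 → (H →L[ℂ] H) →L[ℂ] (H →L[ℂ] H)) : Prop where
  zero : T 0 = ContinuousLinearMap.id ℂ (H →L[ℂ] H)
  add : ∀ s t, T (s + t) = (T s).comp (T t)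
  completelyPositive : ∀ t, ∃ φ : CompletelyPositiveMap (H →L[ℂ] H) (H →L[ℂ] H),
    φ.toLinearMap = (T t : (H →L[ℂ] H) →ₗ[ℂ] (H →L[ℂ] H))
  map_one : ∀ t, T t 1 = 1
  normal : ∀ t, IsNormalMap (T t)
  uniformlyContinuous : Tendsto T (𝓝[>] 0) (𝓝 (ContinuousLinearMap.id ℂ (H →L[ℂ] H)))

/-- `𝓛` is the generator of `T`: `(T_t - id) / t → 𝓛` in operator norm as `t → 0+`. -/
def IsGenerator (T : ℝ≥0 → (H →L[ℂ] H) →L[ℂ] (H →L[ℂ] H))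
    (𝓛 : (H →L[ℂ] H) →L[ℂ] (H →L[ℂ] H)) : Prop :=
  Tendsto (fun t : ℝ≥0 => ((t : ℝ) : ℂ)⁻¹ • (T t - ContinuousLinearMap.id ℂ (H →L[ℂ] H)))
    (𝓝[>] 0) (𝓝 𝓛)

/-- `𝓛` has the GKSL form with Hamiltonian `K` and Lindblad operators `V l`:
`𝓛 x = i[K, x] - ½ ∑ (V l* V l x - 2 V l* x V l + x V l* V l)`, with `K` self-adjoint and
`∑ V l* V l` strongly convergent; the series for `𝓛 x` converges strongly. -/
def IsGKSL {ι : Type*} (𝓛 : (H →L[ℂ] H) →L[ℂ] (H →L[ℂ] H)) (K : H →L[ℂ] H)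
    (V : ι → H →L[ℂ] H) : Prop :=
  IsSelfAdjoint K ∧
  (∃ S : H →L[ℂ] H, ∀ u : H, HasSum (fun l => (star (V l) * V l) u) (S u)) ∧
  ∀ (x : H →L[ℂ] H) (u : H),
    HasSum (fun l => (-(1 / 2 : ℂ)) •
        (star (V l) * V l * x - (2 : ℂ) • (star (V l) * x * V l) + x * star (V l) * V l) u)
      ((𝓛 x - Complex.I • (K * x - x * K)) u)

/-- The decoherence-free subalgebra `N(T)`, as a set of operators. -/
def decoherenceFree (T : ℝ≥0 → (H →L[ℂ] H) →L[ℂ] (H →L[ℂ] H)) : Set (H →L[ℂ] H) :=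
  {x | ∀ t, T t (star x * x) = star (T t x) * T t x ∧ T t (x * star x) = T t x * star (T t x)}

/-- `φ` is a faithful normal state on `B(H)`. -/
structure IsFaithfulNormalState (φ : (H →L[ℂ] H) →ₗ[ℂ] ℂ) : Prop where
  nonneg : ∀ x, 0 ≤ x → 0 ≤ φ x
  map_one : φ 1 = 1
  normal : IsNormalMap φ
  faithful : ∀ x, 0 ≤ x → φ x = 0 → x = 0

/-- `φ` is invariant under the semigroup `T`. -/
def IsInvariant (T : ℝ≥0 → (H →L[ℂ] H) →L[ℂ] (H →L[ℂ] H)) (φ : (H →L[ℂ] H) →ₗ[ℂ] ℂ) : Prop :=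
  ∀ t x, φ (T t x) = φ x

end Semigroups

/-! ### Translation operators on `ℓ²(G)` and the group von Neumann algebras -/

section Group

/-- The Hilbert space `ℓ²(G)`. -/
abbrev ell2 (G : Type*) : Type _ := lp (fun _ : G => ℂ) 2

/-- The bounded operator `u ↦ u ∘ σ` on `ℓ²(G)`, for a permutation `σ` of `G`. -/
def permOp {G : Type*} (σ : Equiv.Perm G) : ell2 G →L[ℂ] ell2 G :=
  LinearIsometry.toContinuousLinearMap
    { toFun := fun u => ⟨fun h => u (σ h), by
        refine (memℓp_gen_iff (by norm_num)).2 ?_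
        exact ((lp.memℓp u).summable (by norm_num)).comp_injective σ.injective⟩
      map_add' := fun _ _ => rfl
      map_smul' := fun _ _ => rfl
      norm_map' := fun u => by
        rw [lp.norm_eq_tsum_rpow (by norm_num), lp.norm_eq_tsum_rpow (by norm_num)]
        congr 1
        exact σ.tsum_eq (fun h => ‖u h‖ ^ (2 : ℝ≥0∞).toReal) }

variable {G : Type*} [Group G]

/-- The left translation operator `L_{1_g}`, `(L_{1_g} u)(h) = u(g⁻¹ h)`. -/
def leftOp (g : G) : ell2 G →L[ℂ] ell2 G := permOp (Equiv.mulLeft g⁻¹)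

/-- The right translation operator `R_{1_g}`, `(R_{1_g} u)(h) = u(h g⁻¹)`. -/
def rightOp (g : G) : ell2 G →L[ℂ] ell2 G := permOp (Equiv.mulRight g⁻¹)

@[simp] theorem leftOp_apply (g h : G) (u : ell2 G) : leftOp g u h = u (g⁻¹ * h) := rfl

@[simp] theorem rightOp_apply (g h : G) (u : ell2 G) : rightOp g u h = u (h * g⁻¹) := rfl

/-- Convolution of functions on `G`. -/
def conv (u v : G → ℂ) (g : G) : ℂ := ∑' k, u k * v (k⁻¹ * g)

/-- `L_{1_g} u = 1_g * u`. -/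
theorem leftOp_eq_conv [DecidableEq G] (g : G) (u : ell2 G) :
    ⇑(leftOp g u) = conv (Pi.single g 1) u := by
  funext h
  rw [conv, tsum_eq_single g]
  · simp
  · intro k hk
    simp [hk]

/-- `R_{1_g} u = u * 1_g`. -/
theorem rightOp_eq_conv [DecidableEq G] (g : G) (u : ell2 G) :
    ⇑(rightOp g u) = conv u (Pi.single g 1) := by
  funext h
  rw [conv, tsum_eq_single (h * g⁻¹)]
  · simp
  · intro k hk
    have : k⁻¹ * h ≠ g := fun e => hk (by rw [← e]; group)
    simp [this]

variable (G) in
/-- The left group von Neumann algebra, generated by the operators `L_{1_g}`. -/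
def leftGroupVN : VonNeumannAlgebra (ell2 G) := generatedVN (Set.range (leftOp (G := G)))

variable (G) in
/-- The right group von Neumann algebra, generated by the operators `R_{1_g}`. -/
def rightGroupVN : VonNeumannAlgebra (ell2 G) := generatedVN (Set.range (rightOp (G := G)))

end Group

end QMS

end

/-!
Let `Φ x = ∑ c_g L_g* x L_g`, so that the generator is `𝓛 = Φ - 1`.

*The semigroup.* The normal completely positive maps form a closed cone that is stable under
composition (`normalCP`, `isClosed_normalCP`). It contains the conjugations by unitaries, hence `Φ`,
hence `exp (t 𝓛) = exp (-t) exp (t Φ)`. Normality rests on Vigier's theorem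
(`exists_re_inner_sub_lt`): suprema of directed families of operators are weak limits, so that
normality can be tested on quadratic forms. A semigroup is determined by its derivative at zero
(`semigroup_unique`).

*The decoherence-free subalgebra.* Differentiating `T_t(x* x) = T_t(x)* T_t(x)` at `t = 0` shows
that the dissipation form `𝓛(x* x) - 𝓛(x)* x - x* 𝓛(x) = ∑ c_g [x, L_g]* [x, L_g]` vanishes, so `x`
commutes with `L_g` whenever `c_g ≠ 0`, and therefore for all `g`
(`decoherenceFree_eq_centralizer`). The commutant of the left translations consists of the right
convolution operators, the commutant of the right translations of the left convolution operators,
and these commute by associativity (`coe_rightGroupVN`).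

*The type.* Central elements are given by square summable functions that are constant on conjugacy
classes, and the non-trivial conjugacy classes of a free group of rank at least two are infinite
(`freeGroup_infinite_conj`). The vector state of `δ₁` is a faithful trace, which makes the identity
finite. If `p` were a minimal projection, a self-adjoint element of its corner would be positive or
negative (`IsMinimalProj.nonneg_or_nonpos`); subtracting a multiple of `p` to make the trace vanish
shows that the corner is `ℂ p`. Then the conjugates `R_g p R_g⁻¹` are almost orthogonal
projections of equal trace, of which a finite trace allows only finitely many
(`not_isMinimalProj`).

*Invariant states.* If `φ` is invariant and `e_h` is the projection onto `ℂ δ_h`, then `h ↦ φ(e_h)`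
is a non-negative summable harmonic function of the random walk with steps distributed according to
`c`. On an infinite group it vanishes by the maximum principle (`eq_zero_of_harmonic`), so `φ` is
not faithful.
-/

namespace QMS

/-! ### Conjugacy classes in free groups -/

section FreeGroup

variable {α : Type*} [DecidableEq α]

theorem toWord_mk_singleton_pow (s : α × Bool) (m : ℕ) :
    (FreeGroup.mk [s] ^ m).toWord = List.replicate m s := by
  rw [FreeGroup.pow_mk, FreeGroup.toWord_mk]
  have : (List.replicate m [s]).flatten = List.replicate m s := by
    induction m with
    | zero => rfl
    | succ m ih => simp [List.replicate_succ, ih]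
  rw [this, FreeGroup.reduce_replicate]

/-- If the first letter of the reduced word of `a` does not involve the generator of the letter `s`
and its last letter is not the inverse of `s`, then no positive power of `s` commutes with `a`:
there is no cancellation in either product, and the two reduced words start with different
letters. -/
theorem pow_mul_ne_mul_pow {a : FreeGroup α} {s p : α × Bool} {L : List (α × Bool)}
    (hw : a.toWord = p :: L) (hp : p.1 ≠ s.1)
    (hlast : ∀ q ∈ a.toWord.getLast?, q.1 = s.1 → q.2 = s.2) {m : ℕ} (hm : m ≠ 0) :
    FreeGroup.mk [s] ^ m * a ≠ a * FreeGroup.mk [s] ^ m := by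
  intro h
  have h' := congrArg FreeGroup.toWord h
  have ha : FreeGroup.IsReduced a.toWord := FreeGroup.isReduced_toWord
  have hs : FreeGroup.IsReduced (List.replicate m s) := by
    rw [← toWord_mk_singleton_pow]; exact FreeGroup.isReduced_toWord
  rw [FreeGroup.toWord_mul, FreeGroup.toWord_mul, toWord_mk_singleton_pow,
    FreeGroup.IsReduced.reduce_eq, FreeGroup.IsReduced.reduce_eq, hw] at h'
  · obtain ⟨k, rfl⟩ := Nat.exists_eq_succ_of_ne_zero hm
    rw [List.replicate_succ] at h'
    simp only [List.cons_append, List.cons.injEq] at h'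
    exact hp (by rw [h'.1])
  · refine List.isChain_append.2 ⟨ha, hs, fun q hq r hr => ?_⟩
    have hr' : r = s := List.eq_of_mem_replicate (List.mem_of_mem_head? hr)
    rw [hr']
    exact hlast q hq
  · refine List.isChain_append.2 ⟨hs, ha, fun q hq r hr hqr => ?_⟩
    have hq' : q = s := List.eq_of_mem_replicate (List.mem_of_mem_getLast? hq)
    rw [hw] at hr
    simp only [List.head?_cons, Option.mem_def, Option.some.injEq] at hr
    exact absurd (by rw [hr, ← hqr, hq']) hp

/-- The non-trivial conjugacy classes of a free group of rank at least two are infinite: the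
conjugates by the powers of a suitable letter are distinct. -/
theorem freeGroup_infinite_conj [Nontrivial α] {a : FreeGroup α} (ha : a ≠ 1) :
    (Set.range fun g : FreeGroup α => g * a * g⁻¹).Infinite := by
  obtain ⟨p, L, hw⟩ := List.exists_cons_of_ne_nil (mt FreeGroup.toWord_eq_nil_iff.1 ha)
  obtain ⟨i, hi⟩ := exists_ne p.1
  -- The sign of the letter is that of the last letter of `a`, which prevents cancellation.
  obtain ⟨s, hs, hlast⟩ : ∃ s : α × Bool, p.1 ≠ s.1 ∧
      ∀ q ∈ a.toWord.getLast?, q.1 = s.1 → q.2 = s.2 := by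
    rcases h : a.toWord.getLast? with _ | q
    · exact ⟨(i, true), hi.symm, by simp⟩
    · exact ⟨(i, q.2), hi.symm, by simp⟩
  set t := FreeGroup.mk [s]
  have key : ∀ k l : ℕ, k < l → t ^ k * a * (t ^ k)⁻¹ ≠ t ^ l * a * (t ^ l)⁻¹ := by
    intro k l hkl h
    obtain ⟨m, rfl⟩ := Nat.exists_eq_add_of_lt hkl
    refine pow_mul_ne_mul_pow hw hs hlast (Nat.succ_ne_zero m) ?_
    have : a = t ^ (m + 1) * a * (t ^ (m + 1))⁻¹ := by
      have h2 := congrArg (fun x => (t ^ k)⁻¹ * x * t ^ k) h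
      simp only [add_assoc, pow_add t k] at h2
      group at h2 ⊢
      exact h2
    rw [eq_mul_inv_iff_mul_eq] at this
    exact this.symm
  refine Set.infinite_of_injective_forall_mem (f := fun k : ℕ => t ^ k * a * (t ^ k)⁻¹) ?_
    fun k => ⟨t ^ k, rfl⟩
  intro k l h
  by_contra hne
  rcases lt_or_gt_of_ne hne with hlt | hlt
  · exact key k l hlt h
  · exact key l k hlt h.symm

end FreeGroup

/-! ### Matrix entries of operators on `ℓ²(G)` -/

section Matrix

variable {G : Type*}

theorem hasSum_norm_sq (u : ell2 G) : HasSum (fun k => ‖u k‖ ^ 2) (‖u‖ ^ 2) := by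
  have := lp.hasSum_norm (p := 2) (by norm_num) u
  simpa using this

variable [DecidableEq G]

/-- The unit vector of `ℓ²(G)` supported at `g`. -/
noncomputable def delta (g : G) : ell2 G := lp.single 2 g 1

theorem delta_apply (g h : G) : delta g h = if h = g then (1 : ℂ) else 0 := by
  by_cases hg : h = g
  · subst hg; simp [delta]
  · simp [delta, hg]

theorem norm_delta (g : G) : ‖delta g‖ = 1 := by
  simp [delta, lp.norm_single]

theorem inner_delta_left (g : G) (u : ell2 G) : inner ℂ (delta g) u = u g := by
  rw [delta, lp.inner_single_left]
  simp

theorem hasSum_apply (x : ell2 G →L[ℂ] ell2 G) (v : ell2 G) (a : G) :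
    HasSum (fun k => v k * x (delta k) a) (x v a) := by
  have h := (lp.hasSum_single (p := 2) (by norm_num) v).mapL
    ((innerSL ℂ (delta a)).comp x)
  simp only [ContinuousLinearMap.comp_apply, innerSL_apply_apply, inner_delta_left] at h
  have h2 : ∀ k, v k * x (delta k) a = x (lp.single 2 k (v k)) a := fun k => by
    have : lp.single 2 k (v k) = v k • delta k := by
      rw [delta, ← lp.single_smul, smul_eq_mul, mul_one]
    rw [this, map_smul]
    rfl
  simp only [h2]
  exact h

theorem ext_delta {x y : ell2 G →L[ℂ] ell2 G} (h : ∀ k a, x (delta k) a = y (delta k) a) :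
    x = y := by
  ext v a
  refine (hasSum_apply x v a).unique ?_
  simp only [h]
  exact hasSum_apply y v a

end Matrix

/-! ### Translation operators and the commutation theorem -/

section Translations

variable {G : Type*}

theorem permOp_mul_symm (σ : Equiv.Perm G) : permOp σ * permOp σ.symm = 1 := by
  ext u h
  change u (σ.symm (σ h)) = u h
  simp

theorem norm_permOp_apply (σ : Equiv.Perm G) (u : ell2 G) : ‖permOp σ u‖ = ‖u‖ := by
  rw [lp.norm_eq_tsum_rpow (by norm_num), lp.norm_eq_tsum_rpow (by norm_num)]
  congr 1
  exact σ.tsum_eq (fun h => ‖u h‖ ^ (2 : ℝ≥0∞).toReal)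

theorem star_permOp (σ : Equiv.Perm G) : star (permOp σ) = permOp σ.symm := by
  have h : star (permOp σ) * permOp σ = 1 :=
    (ContinuousLinearMap.norm_map_iff_adjoint_comp_self _).1
      (norm_permOp_apply σ)
  calc star (permOp σ) = star (permOp σ) * (permOp σ * permOp σ.symm) := by
        rw [permOp_mul_symm, mul_one]
    _ = permOp σ.symm := by rw [← mul_assoc, h, one_mul]

variable [Group G]

theorem star_leftOp (g : G) : star (leftOp g) = leftOp g⁻¹ := by
  rw [leftOp, star_permOp, leftOp]
  congr 1
  ext; simp

theorem star_rightOp (g : G) : star (rightOp g) = rightOp g⁻¹ := by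
  rw [rightOp, star_permOp, rightOp]
  congr 1
  ext; simp

theorem leftOp_mul (g h : G) : leftOp (g * h) = leftOp g * leftOp h := by
  ext u k
  change u ((g * h)⁻¹ * k) = u (h⁻¹ * (g⁻¹ * k))
  simp [mul_assoc]

theorem leftOp_one : leftOp (1 : G) = 1 := by
  ext u k
  simp

theorem rightOp_mul (g h : G) : rightOp (h * g) = rightOp g * rightOp h := by
  ext u k
  change u (k * (h * g)⁻¹) = u (k * g⁻¹ * h⁻¹)
  simp [mul_assoc]

theorem rightOp_one : rightOp (1 : G) = 1 := by
  ext u k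
  simp

theorem star_leftOp_mul_self (g : G) : star (leftOp g) * leftOp g = 1 := by
  rw [star_leftOp, ← leftOp_mul, inv_mul_cancel, leftOp_one]

theorem leftOp_mul_star_self (g : G) : leftOp g * star (leftOp g) = 1 := by
  rw [star_leftOp, ← leftOp_mul, mul_inv_cancel, leftOp_one]

theorem star_range_leftOp : star (Set.range (leftOp (G := G))) = Set.range leftOp := by
  ext x
  constructor
  · rintro ⟨g, hg⟩
    exact ⟨g⁻¹, by rw [← star_leftOp, hg, star_star]⟩
  · rintro ⟨g, rfl⟩
    exact ⟨g⁻¹, by rw [star_leftOp]⟩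

theorem star_range_rightOp : star (Set.range (rightOp (G := G))) = Set.range rightOp := by
  ext x
  constructor
  · rintro ⟨g, hg⟩
    exact ⟨g⁻¹, by rw [← star_rightOp, hg, star_star]⟩
  · rintro ⟨g, rfl⟩
    exact ⟨g⁻¹, by rw [star_rightOp]⟩

theorem leftOp_commute_rightOp (g h : G) : leftOp g * rightOp h = rightOp h * leftOp g := by
  ext u k
  change u (g⁻¹ * k * h⁻¹) = u (g⁻¹ * (k * h⁻¹))
  rw [mul_assoc]

variable [DecidableEq G]

theorem leftOp_delta (g k : G) : leftOp g (delta k) = delta (g * k) := by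
  ext h
  simp [delta_apply, inv_mul_eq_iff_eq_mul]

theorem rightOp_delta (g k : G) : rightOp g (delta k) = delta (k * g) := by
  ext h
  simp [delta_apply, mul_inv_eq_iff_eq_mul]

/-- An operator commuting with all left translations is a right convolution operator. -/
theorem apply_delta_of_mem_centralizer_leftOp {x : ell2 G →L[ℂ] ell2 G}
    (hx : x ∈ Set.centralizer (Set.range leftOp)) (b a : G) :
    x (delta b) a = x (delta 1) (b⁻¹ * a) := by
  have h := congrArg (fun z : ell2 G →L[ℂ] ell2 G => z (delta 1) a) (hx (leftOp b) ⟨b, rfl⟩)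
  have h' : x (leftOp b (delta 1)) a = leftOp b (x (delta 1)) a := h.symm
  rwa [leftOp_delta, mul_one, leftOp_apply] at h'

/-- An operator commuting with all right translations is a left convolution operator. -/
theorem apply_delta_of_mem_centralizer_rightOp {x : ell2 G →L[ℂ] ell2 G}
    (hx : x ∈ Set.centralizer (Set.range rightOp)) (b a : G) :
    x (delta b) a = x (delta 1) (a * b⁻¹) := by
  have h := congrArg (fun z : ell2 G →L[ℂ] ell2 G => z (delta 1) a) (hx (rightOp b) ⟨b, rfl⟩)
  have h' : x (rightOp b (delta 1)) a = rightOp b (x (delta 1)) a := h.symm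
  rwa [rightOp_delta, one_mul, rightOp_apply] at h'

/-- Left and right convolution operators commute, by associativity of convolution. -/
theorem mul_comm_of_mem_centralizer {x y : ell2 G →L[ℂ] ell2 G}
    (hx : x ∈ Set.centralizer (Set.range leftOp))
    (hy : y ∈ Set.centralizer (Set.range rightOp)) : x * y = y * x := by
  refine ext_delta fun b a => ?_
  change x (y (delta b)) a = y (x (delta b)) a
  refine (hasSum_apply x (y (delta b)) a).unique ?_
  have h := hasSum_apply y (x (delta b)) a
  let e : G ≃ G := (Equiv.inv G).trans ((Equiv.mulLeft b).trans (Equiv.mulRight a))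
  rw [← e.hasSum_iff] at h
  convert h using 2 with k
  simp only [Function.comp_apply, e, Equiv.trans_apply, Equiv.inv_apply, Equiv.coe_mulLeft,
    Equiv.coe_mulRight]
  rw [apply_delta_of_mem_centralizer_rightOp hy b, apply_delta_of_mem_centralizer_leftOp hx k,
    apply_delta_of_mem_centralizer_leftOp hx b,
    apply_delta_of_mem_centralizer_rightOp hy (b * k⁻¹ * a), mul_comm]
  congr 2 <;> group

end Translations

section CommutationTheorem

variable {G : Type*} [Group G]

/-- The commutation theorem for the group von Neumann algebras. -/
theorem coe_rightGroupVN :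
    (rightGroupVN G : Set (ell2 G →L[ℂ] ell2 G)) = Set.centralizer (Set.range leftOp) := by
  classical
  rw [rightGroupVN, coe_generatedVN, star_range_rightOp, Set.union_self]
  refine Set.Subset.antisymm (Set.centralizer_subset ?_) fun x hx y hy =>
    (mul_comm_of_mem_centralizer hx hy).symm
  rintro _ ⟨g, rfl⟩ _ ⟨h, rfl⟩
  exact (leftOp_commute_rightOp g h).symm

theorem coe_commutant_leftGroupVN :
    ((leftGroupVN G).commutant : Set (ell2 G →L[ℂ] ell2 G)) =
      Set.centralizer (Set.range leftOp) := by
  rw [VonNeumannAlgebra.coe_commutant, leftGroupVN, coe_generatedVN, star_range_leftOp,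
    Set.union_self, Set.centralizer_centralizer_centralizer]

end CommutationTheorem

/-! ### Positive operators and minimal projections -/

section Positive

variable {H : Type*} [NormedAddCommGroup H] [InnerProductSpace ℂ H] [CompleteSpace H]

theorem nonneg_iff_re_inner {a : H →L[ℂ] H} (ha : IsSelfAdjoint a) :
    0 ≤ a ↔ ∀ u, 0 ≤ (inner ℂ u (a u)).re := by
  rw [ContinuousLinearMap.nonneg_iff_isPositive, ContinuousLinearMap.isPositive_def']
  simp only [ha, true_and, ContinuousLinearMap.reApplyInnerSelf_apply]
  refine forall_congr' fun u => ?_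
  rw [inner_re_symm]
  rfl

theorem inner_star_mul_self (b : H →L[ℂ] H) (u : H) :
    inner ℂ u ((star b * b) u) = (‖b u‖ : ℂ) ^ 2 := by
  have h1 : inner ℂ u ((star b * b) u) = inner ℂ (b u) (b u) :=
    ContinuousLinearMap.adjoint_inner_right b u (b u)
  rw [h1, inner_self_eq_norm_sq_to_K]
  rfl

/-- The inequality `a² ≤ ‖a‖ a` for a positive operator `a`, in terms of quadratic forms. -/
theorem norm_apply_sq_le {a : H →L[ℂ] H} (ha : 0 ≤ a) (u : H) :
    ‖a u‖ ^ 2 ≤ ‖a‖ * (inner ℂ u (a u)).re := by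
  obtain ⟨b, rfl⟩ := CStarAlgebra.nonneg_iff_eq_star_mul_self.1 ha
  rw [inner_star_mul_self, CStarRing.norm_star_mul_self]
  have h2 : ‖(star b * b) u‖ ≤ ‖b‖ * ‖b u‖ := by
    rw [← norm_star b]; exact (star b).le_opNorm (b u)
  calc ‖(star b * b) u‖ ^ 2 ≤ (‖b‖ * ‖b u‖) ^ 2 := by gcongr
    _ = ‖b‖ * ‖b‖ * ‖b u‖ ^ 2 := by ring
    _ = _ := by norm_cast

theorem mem_of_forall_commutant {M : VonNeumannAlgebra H} {x : H →L[ℂ] H}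
    (h : ∀ y ∈ M.commutant, y * x = x * y) : x ∈ M := by
  rw [← VonNeumannAlgebra.commutant_commutant M, VonNeumannAlgebra.mem_commutant_iff]
  exact h

/-- A minimal projection carries no two non-zero orthogonal elements of the algebra: the support
projection of one of them would be a proper subprojection. -/
theorem IsMinimalProj.eq_zero_or_eq_zero {M : VonNeumannAlgebra H} {p a b : H →L[ℂ] H}
    (hp : IsMinimalProj M p) (ha : a ∈ M) (hap : a * p = a) (hpb : p * b = b) (hab : a * b = 0) :
    a = 0 ∨ b = 0 := by
  obtain ⟨-, hpp, -, hmin⟩ := hp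
  set K : Submodule ℂ H := a.ker
  have hK : IsClosed (K : Set H) := a.isClosed_ker
  have : CompleteSpace K := hK.completeSpace_coe
  have hq : Kᗮ.starProjection ∈ M := by
    rw [VonNeumannAlgebra.IsStarProjection.mem_iff isStarProjection_starProjection]
    intro y hy v hv
    have hcomm : a * star y = star y * a :=
      VonNeumannAlgebra.mem_commutant_iff.1 (star_mem hy) a ha
    rw [Submodule.range_starProjection] at hv
    rw [Submodule.mem_comap, Submodule.range_starProjection]
    rw [Submodule.mem_orthogonal] at hv ⊢
    intro w hw
    have hw' : star y w ∈ K := by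
      have := congrArg (fun z : H →L[ℂ] H => z w) hcomm
      change a (star y w) = star y (a w) at this
      have hw0 : a w = 0 := hw
      rw [hw0, map_zero] at this
      exact this
    have := hv _ hw'
    rwa [ContinuousLinearMap.star_eq_adjoint, ContinuousLinearMap.adjoint_inner_left] at this
  have hqp : Kᗮ.starProjection ≤ p := by
    obtain ⟨U, hU, rfl⟩ := isStarProjection_iff_eq_starProjection.1 hpp
    rw [Submodule.starProjection_le_starProjection_iff, Submodule.orthogonal_le_iff_orthogonal_le]
    intro v hv
    have h0 : U.starProjection v = 0 :=
      (Submodule.starProjection_apply_eq_zero_iff (K := U)).2 hv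
    change a v = 0
    rw [← hap]
    change a (U.starProjection v) = 0
    rw [h0, map_zero]
  rcases hmin _ hq isStarProjection_starProjection hqp with h | h
  · left
    ext v
    have : v ∈ K := by
      have h1 : Kᗮ.starProjection v = 0 := by rw [h]; rfl
      have h2 := (Submodule.starProjection_apply_eq_zero_iff (K := Kᗮ)).1 h1
      rwa [Submodule.orthogonal_orthogonal] at h2
    exact this
  · right
    rw [← hpb, ← h]
    ext v
    change Kᗮ.starProjection (b v) = 0
    rw [Submodule.starProjection_apply_eq_zero_iff, Submodule.orthogonal_orthogonal]
    exact congrArg (fun z : H →L[ℂ] H => z v) hab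

theorem mul_eq_zero_of_star_mul_self_mul {a r : H →L[ℂ] H} (h : star a * a * r = 0) :
    a * r = 0 := by
  rw [← CStarRing.star_mul_self_eq_zero_iff, star_mul]
  simp only [mul_assoc] at h ⊢
  rw [h, mul_zero]

/-- A self-adjoint element of the corner of a minimal projection is positive or negative. -/
theorem IsMinimalProj.nonneg_or_nonpos {M : VonNeumannAlgebra H} {p z : H →L[ℂ] H}
    (hp : IsMinimalProj M p) (hz : z ∈ M) (hsa : IsSelfAdjoint z) (hzp : z * p = z) :
    0 ≤ z ∨ 0 ≤ -z := by
  have hpos : z⁺ ∈ M := mem_of_forall_commutant fun y hy => by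
    rw [CFC.posPart_def]
    exact ((hsa.commute_cfcₙ
      ((VonNeumannAlgebra.mem_commutant_iff.1 hy z hz : Commute z y)) _).symm).eq
  have h1 : z⁺ * z⁻ = 0 := CFC.posPart_mul_negPart z
  have h2 : z⁻ * z⁺ = 0 := CFC.negPart_mul_posPart z
  have h3 : z⁺ - z⁻ = z := CFC.posPart_sub_negPart z hsa
  have s1 : star z⁺ = z⁺ := (CFC.posPart_nonneg z).isSelfAdjoint
  have s2 : star z⁻ = z⁻ := (CFC.negPart_nonneg z).isSelfAdjoint
  have hz0 : z * (1 - p) = 0 := by rw [mul_sub, mul_one, hzp, sub_self]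
  have h4 : z⁺ * (1 - p) = 0 := by
    apply mul_eq_zero_of_star_mul_self_mul
    have : z⁺ * z⁺ = z⁺ * z := by
      have := mul_sub z⁺ z⁺ z⁻
      rw [h3, h1, sub_zero] at this
      exact this.symm
    rw [s1, this, mul_assoc, hz0, mul_zero]
  have h5 : z⁻ * (1 - p) = 0 := by
    apply mul_eq_zero_of_star_mul_self_mul
    have : z⁻ * z⁻ = -(z⁻ * z) := by
      have := mul_sub z⁻ z⁺ z⁻
      rw [h3, h2, zero_sub] at this
      rw [this, neg_neg]
    rw [s2, this, neg_mul, mul_assoc, hz0, mul_zero, neg_zero]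
  rw [mul_sub, mul_one, sub_eq_zero] at h4 h5
  have h6 : p * z⁻ = z⁻ := by
    have := congrArg star h5
    rw [star_mul, s2, hp.2.1.isSelfAdjoint.star_eq] at this
    exact this.symm
  rcases hp.eq_zero_or_eq_zero hpos h4.symm h6 h1 with h | h
  · right
    rw [← h3, h, zero_sub, neg_neg]
    exact CFC.negPart_nonneg z
  · left
    rw [← h3, h, sub_zero]
    exact CFC.posPart_nonneg z

end Positive

/-! ### The trace of the group von Neumann algebra -/

section Trace

variable {G : Type*} [Group G]

theorem mem_rightGroupVN {x : ell2 G →L[ℂ] ell2 G} :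
    x ∈ rightGroupVN G ↔ x ∈ Set.centralizer (Set.range leftOp) := by
  rw [← coe_rightGroupVN]; rfl

theorem rightOp_mem (g : G) : rightOp g ∈ rightGroupVN G :=
  subset_generatedVN _ ⟨g, rfl⟩

theorem smul_mem_vn {H : Type*} [NormedAddCommGroup H] [InnerProductSpace ℂ H] [CompleteSpace H]
    {M : VonNeumannAlgebra H} {x : H →L[ℂ] H} (c : ℂ) (hx : x ∈ M) : c • x ∈ M :=
  M.toStarSubalgebra.smul_mem hx c

variable [DecidableEq G]

/-- The vector state `x ↦ ⟨δ₁, x δ₁⟩`, which is the trace of the group von Neumann algebra. -/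
noncomputable def trace (x : ell2 G →L[ℂ] ell2 G) : ℂ := inner ℂ (delta 1) (x (delta 1))

theorem trace_eq (x : ell2 G →L[ℂ] ell2 G) : trace x = x (delta 1) 1 := inner_delta_left _ _

theorem trace_smul (c : ℂ) (x : ell2 G →L[ℂ] ell2 G) : trace (c • x) = c * trace x :=
  inner_smul_right _ _ _

theorem trace_sub (x y : ell2 G →L[ℂ] ell2 G) : trace (x - y) = trace x - trace y :=
  inner_sub_right _ _ _

theorem trace_one : trace (1 : ell2 G →L[ℂ] ell2 G) = 1 := by
  rw [trace_eq]
  simp [delta_apply]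

theorem trace_star_mul (x y : ell2 G →L[ℂ] ell2 G) :
    trace (star x * y) = inner ℂ (x (delta 1)) (y (delta 1)) :=
  ContinuousLinearMap.adjoint_inner_right x _ _

theorem trace_star (x : ell2 G →L[ℂ] ell2 G) : trace (star x) = star (trace x) := by
  have h := trace_star_mul x 1
  rw [mul_one] at h
  rw [h, trace]
  exact (inner_conj_symm _ _).symm

theorem trace_mul_comm {x y : ell2 G →L[ℂ] ell2 G} (hx : x ∈ rightGroupVN G)
    (hy : y ∈ rightGroupVN G) : trace (x * y) = trace (y * x) := by
  rw [mem_rightGroupVN] at hx hy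
  rw [trace_eq, trace_eq]
  change x (y (delta 1)) 1 = y (x (delta 1)) 1
  refine (hasSum_apply x (y (delta 1)) 1).unique ?_
  have h := hasSum_apply y (x (delta 1)) 1
  rw [← (Equiv.inv G).hasSum_iff] at h
  convert h using 2 with k
  simp only [Function.comp_apply, Equiv.inv_apply]
  rw [apply_delta_of_mem_centralizer_leftOp hx k, apply_delta_of_mem_centralizer_leftOp hy k⁻¹,
    mul_comm]
  simp

/-- The vector `δ₁` is separating for the group von Neumann algebra. -/
theorem eq_zero_of_apply_delta_one {x : ell2 G →L[ℂ] ell2 G} (hx : x ∈ rightGroupVN G)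
    (h : x (delta 1) = 0) : x = 0 := by
  rw [mem_rightGroupVN] at hx
  refine ext_delta fun b a => ?_
  rw [apply_delta_of_mem_centralizer_leftOp hx, h]
  rfl

/-- The trace is faithful on positive elements. -/
theorem eq_zero_of_trace_eq_zero {x : ell2 G →L[ℂ] ell2 G} (hx : x ∈ rightGroupVN G)
    (h0 : 0 ≤ x) (h : trace x = 0) : x = 0 := by
  refine eq_zero_of_apply_delta_one hx ?_
  have := norm_apply_sq_le h0 (delta 1)
  rw [← trace, h, Complex.zero_re, mul_zero] at this
  simpa using this

theorem trace_star_mul_self (x : ell2 G →L[ℂ] ell2 G) :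
    trace (star x * x) = (‖x (delta 1)‖ : ℂ) ^ 2 :=
  inner_star_mul_self x _

/-- A group with infinite non-trivial conjugacy classes has a von Neumann algebra with trivial
center: a central element is given by a square summable function that is constant on conjugacy
classes. -/
theorem isFactor_rightGroupVN
    (hG : ∀ a : G, a ≠ 1 → (Set.range fun g : G => g * a * g⁻¹).Infinite) :
    IsFactor (rightGroupVN G) := by
  refine Set.Subset.antisymm ?_ ?_
  · rintro x ⟨hx, hc⟩
    rw [mem_rightGroupVN] at hx
    have hR : x ∈ Set.centralizer (Set.range rightOp) := by
      rintro _ ⟨g, rfl⟩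
      exact (hc _ (rightOp_mem g)).symm
    have hconj : ∀ a g : G, x (delta 1) (g * a * g⁻¹) = x (delta 1) a := by
      intro a g
      have h1 := apply_delta_of_mem_centralizer_leftOp hx g (g * a)
      rw [apply_delta_of_mem_centralizer_rightOp hR g] at h1
      rw [h1]
      simp
    have hzero : ∀ a : G, a ≠ 1 → x (delta 1) a = 0 := by
      intro a ha
      by_contra hne
      have hpos : 0 < ‖x (delta 1) a‖ ^ 2 := by positivity
      have hev := (hasSum_norm_sq (x (delta 1))).summable.tendsto_cofinite_zero.eventually
        (gt_mem_nhds hpos)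
      refine hG a ha (Set.Finite.subset hev ?_)
      rintro _ ⟨g, rfl⟩
      simp [hconj]
    refine ⟨x (delta 1) 1, ext_delta fun b a => ?_⟩
    rw [apply_delta_of_mem_centralizer_leftOp hx b a]
    change x (delta 1) 1 * delta b a = _
    rw [delta_apply]
    by_cases hab : a = b
    · simp [hab]
    · rw [hzero (b⁻¹ * a) (by rwa [Ne, inv_mul_eq_one, eq_comm])]
      simp [hab]
  · rintro _ ⟨z, rfl⟩
    exact ⟨smul_mem_vn z (one_mem _), fun y _ => by simp⟩

/-- The identity is finite: `1 - u u*` is positive of trace `1 - trace (u* u) = 0`. -/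
theorem isFiniteProj_one : IsFiniteProj (rightGroupVN G) 1 := by
  refine ⟨one_mem _, IsStarProjection.one _, fun u hu h1 h2 => ?_⟩
  have hm : 1 - u * star u ∈ rightGroupVN G := sub_mem (one_mem _) (mul_mem hu (star_mem hu))
  have := eq_zero_of_trace_eq_zero hm (sub_nonneg.2 h2) (by
    rw [trace_sub, trace_mul_comm hu (star_mem hu), h1, sub_self])
  exact (sub_eq_zero.1 this).symm

/-- The corner of a minimal projection `p` consists of multiples of `p`; the self-adjoint case. -/
theorem IsMinimalProj.trace_smul_eq_of_isSelfAdjoint {p y : ell2 G →L[ℂ] ell2 G}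
    (hp : IsMinimalProj (rightGroupVN G) p) (hy : y ∈ rightGroupVN G) (hsa : IsSelfAdjoint y)
    (hyp : y * p = y) (htp : trace p ≠ 0) : trace p • y = trace y • p := by
  set c : ℂ := trace y / trace p
  have hc : star c = c := by
    rw [star_div₀, ← trace_star, ← trace_star, hsa.star_eq, hp.2.1.isSelfAdjoint.star_eq]
  -- The difference `y - c p` has trace zero, and it is positive or negative.
  have hz : y - c • p = 0 := by
    have hm : y - c • p ∈ rightGroupVN G := sub_mem hy (smul_mem_vn c hp.1)
    have ht : trace (y - c • p) = 0 := by
      rw [trace_sub, trace_smul, div_mul_cancel₀ _ htp, sub_self]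
    rcases hp.nonneg_or_nonpos hm (by
        rw [IsSelfAdjoint, star_sub, star_smul, hc, hsa.star_eq, hp.2.1.isSelfAdjoint.star_eq])
        (by rw [sub_mul, smul_mul_assoc, hyp, hp.2.1.isIdempotentElem.eq]) with h | h
    · exact eq_zero_of_trace_eq_zero hm h ht
    · refine neg_eq_zero.1 (eq_zero_of_trace_eq_zero (neg_mem hm) h ?_)
      rw [← neg_one_smul ℂ, trace_smul, ht, mul_zero]
  rw [sub_eq_zero.1 hz, trace_smul, smul_smul, mul_comm]

/-- The corner of a minimal projection `p` consists of multiples of `p`, with the factor determined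
by the trace. -/
theorem IsMinimalProj.trace_smul_eq {p x : ell2 G →L[ℂ] ell2 G}
    (hp : IsMinimalProj (rightGroupVN G) p) (hx : x ∈ rightGroupVN G) (htp : trace p ≠ 0) :
    trace p • (p * x * p) = trace (p * x * p) • p := by
  have hps := hp.2.1.isSelfAdjoint.star_eq
  have hpi := hp.2.1.isIdempotentElem.eq
  have key : ∀ s : ell2 G →L[ℂ] ell2 G, s ∈ rightGroupVN G → IsSelfAdjoint s →
      trace p • (p * s * p) = trace (p * s * p) • p := fun s hs hsa =>
    hp.trace_smul_eq_of_isSelfAdjoint (mul_mem (mul_mem hp.1 hs) hp.1)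
      (by rw [IsSelfAdjoint, star_mul, star_mul, hps, hsa.star_eq, mul_assoc])
      (by rw [mul_assoc, hpi]) htp
  have h1 := key (x + star x) (add_mem hx (star_mem hx)) (IsSelfAdjoint.add_star_self x)
  have h2 := key (Complex.I • (x - star x)) (smul_mem_vn _ (sub_mem hx (star_mem hx))) (by
    rw [IsSelfAdjoint, star_smul, star_sub, star_star, Complex.star_def, Complex.conj_I, neg_smul,
      ← smul_neg, neg_sub])
  have hx2 : p * x * p = (1 / 2 : ℂ) • (p * (x + star x) * p) +
      (-Complex.I / 2) • (p * (Complex.I • (x - star x)) * p) := by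
    simp only [mul_smul_comm, smul_mul_assoc, smul_smul, mul_add, add_mul, mul_sub, sub_mul]
    rw [show -Complex.I / 2 * Complex.I = 1 / 2 by
      rw [div_mul_eq_mul_div, neg_mul, Complex.I_mul_I]; norm_num]
    module
  have ht : ∀ (a b : ℂ) (y z : ell2 G →L[ℂ] ell2 G),
      trace (a • y + b • z) = a * trace y + b * trace z := fun a b y z => by
    rw [← trace_smul, ← trace_smul]; exact inner_add_right _ _ _
  rw [hx2, ht, smul_add, smul_comm (trace p), smul_comm (trace p), h1, h2]
  module

/-- The von Neumann algebra of an infinite group, if it had a minimal projection `p`, would contain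
the infinitely many conjugates `p_g = R_g p R_g⁻¹`. As the corner of `p` is one-dimensional, the
vectors `p_g δ₁` are almost orthogonal: `∑ₕ ⟨p_g δ₁, p_h δ₁⟩ = 1`. But they all have the same
inner product `trace p ≠ 0` with `δ₁`. -/
theorem not_isMinimalProj [Infinite G] (p : ell2 G →L[ℂ] ell2 G) :
    ¬ IsMinimalProj (rightGroupVN G) p := by
  intro hp
  have hps := hp.2.1.isSelfAdjoint.star_eq
  have hpi := hp.2.1.isIdempotentElem.eq
  set ζ := p (delta 1) with hζ
  set t : ℝ := ‖ζ‖ ^ 2 with ht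
  have htr : trace p = t := by
    have := trace_star_mul_self p
    rw [hps, hpi] at this
    rw [this, ht]; norm_cast
  have hζ0 : ζ ≠ 0 := fun h => hp.2.2.1 (eq_zero_of_apply_delta_one hp.1 h)
  have ht0 : 0 < t := by positivity
  have htp : trace p ≠ 0 := by rw [htr]; exact_mod_cast ht0.ne'
  have hpR : ∀ k : G, trace (p * rightOp k) = star (ζ k) := by
    intro k
    have : trace (p * rightOp k) = trace (star p * rightOp k) := by rw [hps]
    rw [this, trace_star_mul, rightOp_delta, one_mul, ← inner_conj_symm, inner_delta_left]
    rfl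
  have hpRi : ∀ k : G, trace (p * rightOp k⁻¹) = ζ k := by
    intro k
    rw [← star_rightOp, trace_mul_comm hp.1 (star_mem (rightOp_mem k))]
    have := trace_star (p * rightOp k)
    rw [star_mul, hps] at this
    rw [this, hpR, star_star]
  set q : G → (ell2 G →L[ℂ] ell2 G) := fun g => rightOp g * p * rightOp g⁻¹ with hq
  have hRR : ∀ g : G, rightOp g⁻¹ * rightOp g = 1 := fun g => by
    rw [← rightOp_mul, mul_inv_cancel, rightOp_one]
  have hqs : ∀ g, star (q g) = q g := fun g => by
    simp only [hq, star_mul, hps, star_rightOp, inv_inv, mul_assoc]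
  have hqt : ∀ g, inner ℂ (delta 1) (q g (delta 1)) = (t : ℂ) := fun g => by
    change trace (rightOp g * p * rightOp g⁻¹) = t
    rw [trace_mul_comm (mul_mem (rightOp_mem g) hp.1) (rightOp_mem g⁻¹), ← mul_assoc, hRR, one_mul,
      htr]
  have hinner : ∀ g h, inner ℂ (q g (delta 1)) (q h (delta 1)) =
      ((‖ζ (h * g⁻¹)‖ ^ 2 / t : ℝ) : ℂ) := by
    intro g h
    rw [← trace_star_mul, hqs]
    set k := h * g⁻¹ with hk
    have e1 : q g * q h = rightOp g * (p * rightOp k * p) * rightOp h⁻¹ := by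
      simp only [hq, hk, rightOp_mul, mul_assoc]
    have e2 : rightOp h⁻¹ * rightOp g = rightOp k⁻¹ := by
      rw [← rightOp_mul, hk]; simp
    have e3 := hp.trace_smul_eq (rightOp_mem k) htp
    have e4 : trace (p * rightOp k * p) = star (ζ k) := by
      rw [trace_mul_comm (mul_mem hp.1 (rightOp_mem k)) hp.1, ← mul_assoc, hpi, hpR]
    rw [e1, trace_mul_comm (mul_mem (rightOp_mem g)
      (mul_mem (mul_mem hp.1 (rightOp_mem k)) hp.1)) (rightOp_mem h⁻¹), ← mul_assoc, e2]
    have e5 : trace p * trace (rightOp k⁻¹ * (p * rightOp k * p)) = star (ζ k) * ζ k := by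
      rw [← trace_smul, ← mul_smul_comm, e3, mul_smul_comm, trace_smul, e4,
        trace_mul_comm (rightOp_mem k⁻¹) hp.1, hpRi]
    rw [htr] at e5
    have ht0' : (t : ℂ) ≠ 0 := by exact_mod_cast ht0.ne'
    push_cast
    rw [eq_div_iff ht0', mul_comm, e5, Complex.star_def, Complex.conj_mul']
  have hsum : ∀ (F : Finset G) (g : G), ∑ h ∈ F, ‖ζ (h * g⁻¹)‖ ^ 2 / t ≤ 1 := by
    intro F g
    rw [← Finset.sum_div, div_le_one ht0]
    have h1 := hasSum_norm_sq ζ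
    rw [← (Equiv.mulRight g⁻¹).hasSum_iff] at h1
    exact sum_le_hasSum F (fun _ _ => by positivity) h1
  have hF : ∀ F : Finset G, (F.card : ℝ) * t ^ 2 ≤ 1 := by
    intro F
    set w : ell2 G := ∑ g ∈ F, q g (delta 1) with hw
    have hw1 : ‖w‖ ^ 2 ≤ F.card := by
      have h1 : ((‖w‖ ^ 2 : ℝ) : ℂ) = ((∑ g ∈ F, ∑ h ∈ F, ‖ζ (h * g⁻¹)‖ ^ 2 / t : ℝ) : ℂ) := by
        have := inner_self_eq_norm_sq_to_K (𝕜 := ℂ) w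
        push_cast
        rw [← Complex.coe_algebraMap] at *
        refine this.symm.trans ?_
        rw [hw, sum_inner]
        refine Finset.sum_congr rfl fun g _ => ?_
        rw [inner_sum]
        refine Finset.sum_congr rfl fun h _ => ?_
        rw [hinner]; push_cast; rfl
      rw [Complex.ofReal_inj.1 h1]
      calc ∑ g ∈ F, ∑ h ∈ F, ‖ζ (h * g⁻¹)‖ ^ 2 / t ≤ ∑ g ∈ F, (1 : ℝ) :=
            Finset.sum_le_sum fun g _ => hsum F g
        _ = F.card := by simp
    have hw2 : inner ℂ (delta 1) w = ((F.card * t : ℝ) : ℂ) := by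
      rw [hw, inner_sum, Finset.sum_congr rfl fun g _ => hqt g]
      simp
    have hw3 : (F.card : ℝ) * t ≤ ‖w‖ := by
      have := norm_inner_le_norm (𝕜 := ℂ) (delta (1 : G)) w
      rw [hw2, norm_delta, one_mul, Complex.norm_real] at this
      exact (le_abs_self _).trans this
    have hw4 : ((F.card : ℝ) * t) ^ 2 ≤ F.card :=
      (pow_le_pow_left₀ (by positivity) hw3 2).trans hw1
    rcases Nat.eq_zero_or_pos F.card with h0 | h0
    · rw [h0]; simp
    · have h0' : (0 : ℝ) < F.card := by exact_mod_cast h0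
      refine le_of_mul_le_mul_left ?_ h0'
      linarith [hw4, mul_pow (F.card : ℝ) t 2]
  obtain ⟨N, hN⟩ := exists_nat_gt (1 / t ^ 2)
  obtain ⟨F, hFc⟩ := Infinite.exists_subset_card_eq G N
  have := hF F
  rw [hFc] at this
  rw [div_lt_iff₀ (by positivity)] at hN
  linarith

theorem isTypeII₁Factor_rightGroupVN [Infinite G]
    (hG : ∀ a : G, a ≠ 1 → (Set.range fun g : G => g * a * g⁻¹).Infinite) :
    IsTypeII₁Factor (rightGroupVN G) := by
  refine ⟨⟨isFactor_rightGroupVN hG, not_isMinimalProj, 1, fun h => ?_, isFiniteProj_one⟩,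
    isFiniteProj_one⟩
  have := trace_one (G := G)
  rw [h, trace_eq] at this
  simp at this

theorem not_isAtomic_rightGroupVN [Infinite G] : ¬ IsAtomic (rightGroupVN G) := by
  intro h
  obtain ⟨q, hq, -⟩ := h 1 (one_mem _) (IsStarProjection.one _) (fun h => by
    have := trace_one (G := G)
    rw [h, trace_eq] at this
    simp at this)
  exact not_isMinimalProj q hq

end Trace

/-! ### Normal completely positive maps -/

section NormalCP

variable {H : Type*} [NormedAddCommGroup H] [InnerProductSpace ℂ H]

theorem nonneg_iff_inner {a : H →L[ℂ] H} : 0 ≤ a ↔ ∀ u, 0 ≤ inner ℂ u (a u) := by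
  rw [ContinuousLinearMap.nonneg_iff_isPositive]
  refine ⟨fun h u => h.inner_nonneg_right u, fun h => ?_⟩
  rw [ContinuousLinearMap.isPositive_iff_complex]
  intro u
  have h1 : 0 ≤ inner ℂ (a u) u := by
    rw [← inner_conj_symm, ← Complex.star_def, star_nonneg_iff]
    exact h u
  obtain ⟨h2, h3⟩ := Complex.nonneg_iff.1 h1
  exact ⟨Complex.ext rfl h3, h2⟩

variable [CompleteSpace H]

/-- Vigier's theorem: a directed family of operators with supremum `s` converges weakly to `s`.
The decreasing net `s - x` converges strongly, because its quadratic forms converge and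
`norm_apply_sq_le` controls the vectors by the forms; its limit has to be zero because `s` is the
least upper bound. -/
theorem exists_re_inner_sub_lt {D : Set (H →L[ℂ] H)} {s : H →L[ℂ] H} (hne : D.Nonempty)
    (hD : DirectedOn (· ≤ ·) D) (hs : IsLUB D s) (u : H) {ε : ℝ} (hε : 0 < ε) :
    ∃ x ∈ D, (inner ℂ u ((s - x) u)).re < ε := by
  obtain ⟨d, hd⟩ := hne
  let I := {x : H →L[ℂ] H // x ∈ D ∧ d ≤ x}
  have : Nonempty I := ⟨⟨d, hd, le_rfl⟩⟩
  have : IsDirectedOrder I := ⟨fun x y => by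
    obtain ⟨z, hz, hxz, hyz⟩ := hD _ x.2.1 _ y.2.1
    exact ⟨⟨z, hz, x.2.2.trans hxz⟩, hxz, hyz⟩⟩
  have hle : ∀ x : I, 0 ≤ s - x.1 := fun x => sub_nonneg.2 (hs.1 x.2.1)
  have hnorm : ∀ x y : I, x ≤ y → ‖y.1 - x.1‖ ≤ ‖s - d‖ := fun x y hxy =>
    CStarAlgebra.norm_le_norm_of_nonneg_of_le (sub_nonneg.2 hxy)
      (sub_le_sub (hs.1 y.2.1) x.2.2)
  have hcauchy : ∀ v : H, ∃ w, Tendsto (fun x : I => (s - x.1) v) atTop (𝓝 w) := by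
    intro v
    refine cauchy_map_iff_exists_tendsto.1 (Metric.cauchy_iff.2 ⟨inferInstance, fun δ hδ => ?_⟩)
    let r : I → ℝ := fun x => (inner ℂ v ((s - x.1) v)).re
    have hr0 : ∀ x, 0 ≤ r x := fun x => (Complex.nonneg_iff.1 (nonneg_iff_inner.1 (hle x) v)).1
    set C := ‖s - d‖ + 1
    have hC : 0 < C := by positivity
    set η := (δ / 2) ^ 2 / C
    have hη : 0 < η := by positivity
    obtain ⟨x₀, hx₀⟩ := exists_lt_of_ciInf_lt (lt_add_of_pos_right (⨅ x, r x) hη)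
    have hclose : ∀ y : I, x₀ ≤ y → ‖(s - y.1) v - (s - x₀.1) v‖ < δ / 2 := by
      intro y hy
      have h1 : ⨅ x, r x ≤ r y := ciInf_le ⟨0, by rintro _ ⟨x, rfl⟩; exact hr0 x⟩ y
      have h2 : (inner ℂ v ((y.1 - x₀.1) v)).re = r x₀ - r y := by
        simp only [r, sub_apply, inner_sub_right, Complex.sub_re]
        ring
      have h3 := norm_apply_sq_le (sub_nonneg.2 hy : 0 ≤ y.1 - x₀.1) v
      have h4 : ‖(y.1 - x₀.1) v‖ ^ 2 < (δ / 2) ^ 2 := by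
        calc ‖(y.1 - x₀.1) v‖ ^ 2 ≤ ‖y.1 - x₀.1‖ * (inner ℂ v ((y.1 - x₀.1) v)).re := h3
          _ ≤ ‖s - d‖ * η := by
              rw [h2]
              refine mul_le_mul (hnorm _ _ hy) (by linarith) ?_ (norm_nonneg _)
              rw [← h2]
              exact (Complex.nonneg_iff.1 (nonneg_iff_inner.1
                (sub_nonneg.2 hy : 0 ≤ y.1 - x₀.1) v)).1
          _ < C * η := by
              refine mul_lt_mul_of_pos_right ?_ hη
              exact lt_add_one _
          _ = (δ / 2) ^ 2 := mul_div_cancel₀ _ hC.ne'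
      have h5 := lt_of_pow_lt_pow_left₀ 2 (by positivity) h4
      have h6 : (s - y.1) v - (s - x₀.1) v = -((y.1 - x₀.1) v) := by
        simp only [sub_apply]
        abel
      rwa [h6, norm_neg]
    refine ⟨(fun x : I => (s - x.1) v) '' Ici x₀, image_mem_map (Ici_mem_atTop x₀), ?_⟩
    rintro _ ⟨y, hy, rfl⟩ _ ⟨z, hz, rfl⟩
    calc dist ((s - y.1) v) ((s - z.1) v)
        ≤ dist ((s - y.1) v) ((s - x₀.1) v) + dist ((s - z.1) v) ((s - x₀.1) v) :=
          dist_triangle_right _ _ _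
      _ < δ / 2 + δ / 2 := by
          rw [dist_eq_norm, dist_eq_norm]
          exact add_lt_add (hclose y hy) (hclose z hz)
      _ = δ := add_halves δ
  choose f hf using hcauchy
  let a : H →L[ℂ] H := ContinuousLinearMap.ofTendstoOfBoundedRange f
    (fun x : I => s - x.1) (tendsto_pi_nhds.2 hf) (by
      refine (Metric.isBounded_closedBall (x := 0) (r := ‖s - d‖)).subset ?_
      rintro _ ⟨x, rfl⟩
      rw [mem_closedBall_zero_iff]
      exact CStarAlgebra.norm_le_norm_of_nonneg_of_le (hle x) (sub_le_sub_left x.2.2 s))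
  have ha : ∀ v, a v = f v := fun v => rfl
  have hlim : ∀ v, Tendsto (fun x : I => inner ℂ v ((s - x.1) v)) atTop (𝓝 (inner ℂ v (a v))) :=
    fun v => tendsto_const_nhds.inner (hf v)
  have ha0 : 0 ≤ a := nonneg_iff_inner.2 fun v =>
    ge_of_tendsto' (hlim v) fun x => nonneg_iff_inner.1 (hle x) v
  have hax : ∀ x : I, a ≤ s - x.1 := fun x => by
    rw [← sub_nonneg, nonneg_iff_inner]
    intro v
    rw [sub_apply, inner_sub_right]
    refine sub_nonneg.2 (le_of_tendsto (hlim v) ?_)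
    filter_upwards [Ici_mem_atTop x] with y hy
    have := nonneg_iff_inner.1 (sub_nonneg.2 hy : 0 ≤ y.1 - x.1) v
    simp only [sub_apply, inner_sub_right] at this ⊢
    rw [sub_nonneg] at this
    exact sub_le_sub_left this _
  have hup : s - a ∈ upperBounds D := fun x hx => by
    obtain ⟨z, hz, hxz, hdz⟩ := hD _ hx _ hd
    exact hxz.trans (le_sub_comm.1 (hax ⟨z, hz, hdz⟩))
  have ha1 : a = 0 := le_antisymm (by simpa using hs.2 hup) ha0
  have h0 := (Complex.continuous_re.tendsto _).comp (hlim u)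
  rw [ha1, zero_apply, inner_zero_right, Complex.zero_re] at h0
  obtain ⟨x, hx⟩ := (h0.eventually (gt_mem_nhds hε)).exists
  exact ⟨x.1, x.2.1, hx⟩

/-- Complete positivity of a bounded operator on `B(H)`. -/
def IsCP (Ψ : (H →L[ℂ] H) →L[ℂ] (H →L[ℂ] H)) : Prop :=
  ∀ (k : ℕ) (M : CStarMatrix (Fin k) (Fin k) (H →L[ℂ] H)), 0 ≤ M → 0 ≤ M.map Ψ

theorem IsCP.exists_completelyPositiveMap {Ψ : (H →L[ℂ] H) →L[ℂ] (H →L[ℂ] H)} (h : IsCP Ψ) :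
    ∃ φ : CompletelyPositiveMap (H →L[ℂ] H) (H →L[ℂ] H),
      φ.toLinearMap = (Ψ : (H →L[ℂ] H) →ₗ[ℂ] (H →L[ℂ] H)) :=
  ⟨{ (Ψ : (H →L[ℂ] H) →ₗ[ℂ] (H →L[ℂ] H)) with map_cstarMatrix_nonneg' := h }, rfl⟩

theorem IsCP.map_nonneg {Ψ : (H →L[ℂ] H) →L[ℂ] (H →L[ℂ] H)} (h : IsCP Ψ) {x : H →L[ℂ] H}
    (hx : 0 ≤ x) : 0 ≤ Ψ x := by
  obtain ⟨φ, hφ⟩ := h.exists_completelyPositiveMap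
  have h1 : φ x = Ψ x := congrArg (fun f : (H →L[ℂ] H) →ₗ[ℂ] (H →L[ℂ] H) => f x) hφ
  rw [← h1]
  exact _root_.map_nonneg φ hx

theorem IsCP.mono {Ψ : (H →L[ℂ] H) →L[ℂ] (H →L[ℂ] H)} (h : IsCP Ψ) {x y : H →L[ℂ] H}
    (hxy : x ≤ y) : Ψ x ≤ Ψ y := by
  rw [← sub_nonneg, ← map_sub]
  exact h.map_nonneg (sub_nonneg.2 hxy)

theorem isClosed_setOf_isCP :
    IsClosed {Ψ : (H →L[ℂ] H) →L[ℂ] (H →L[ℂ] H) | IsCP Ψ} := by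
  simp only [IsCP, ofPred_forall]
  refine isClosed_iInter fun k => isClosed_iInter fun M => isClosed_iInter fun _ => ?_
  have hcont : Continuous fun Ψ : (H →L[ℂ] H) →L[ℂ] (H →L[ℂ] H) => M.map Ψ := by
    refine continuous_matrix fun i j => ?_
    exact (ContinuousLinearMap.apply ℂ (H →L[ℂ] H) (M i j)).continuous
  exact (CStarAlgebra.isClosed_nonneg
    (A := CStarMatrix (Fin k) (Fin k) (H →L[ℂ] H))).preimage hcont

/-- Normality in terms of the quadratic forms: weak convergence along directed families that have
a supremum. Unlike `IsNormalMap`, it visibly passes to sums and norm limits of positive maps. -/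
def IsWeaklyNormal (Ψ : (H →L[ℂ] H) →L[ℂ] (H →L[ℂ] H)) : Prop :=
  ∀ (D : Set (H →L[ℂ] H)) (s : H →L[ℂ] H), D.Nonempty → DirectedOn (· ≤ ·) D → IsLUB D s →
    ∀ (u : H) (ε : ℝ), 0 < ε → ∃ x ∈ D, (inner ℂ u (Ψ (s - x) u)).re < ε

theorem IsWeaklyNormal.isNormalMap {Ψ : (H →L[ℂ] H) →L[ℂ] (H →L[ℂ] H)} (h : IsWeaklyNormal Ψ)
    (hcp : IsCP Ψ) : IsNormalMap Ψ := by
  intro D s hne hD hs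
  refine ⟨?_, fun y hy => ?_⟩
  · rintro _ ⟨x, hx, rfl⟩
    exact hcp.mono (hs.1 hx)
  · obtain ⟨d, hd⟩ := hne
    have hsa : IsSelfAdjoint (y - Ψ s) := by
      have h1 : 0 ≤ y - Ψ d := sub_nonneg.2 (hy ⟨d, hd, rfl⟩)
      have h2 : 0 ≤ Ψ s - Ψ d := sub_nonneg.2 (hcp.mono (hs.1 hd))
      have := h1.isSelfAdjoint.sub h2.isSelfAdjoint
      rwa [sub_sub_sub_cancel_right] at this
    rw [← sub_nonneg, nonneg_iff_re_inner hsa]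
    intro u
    refine le_of_forall_pos_lt_add fun ε hε => ?_
    obtain ⟨x, hx, hlt⟩ := h D s ⟨d, hd⟩ hD hs u ε hε
    have h3 := (Complex.nonneg_iff.1
      (nonneg_iff_inner.1 (sub_nonneg.2 (hy ⟨x, hx, rfl⟩)) u)).1
    simp only [map_sub, sub_apply, inner_sub_right, Complex.sub_re]
      at hlt h3 ⊢
    linarith

variable (H) in
/-- The normal completely positive maps on `B(H)`, as a subsemiring of the bounded operators on
`B(H)`. -/
noncomputable def normalCP : Subsemiring ((H →L[ℂ] H) →L[ℂ] (H →L[ℂ] H)) where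
  carrier := {Ψ | IsCP Ψ ∧ IsWeaklyNormal Ψ}
  zero_mem' := ⟨fun k M _ => le_of_eq rfl, fun D s hne _ _ u ε hε => by
    obtain ⟨d, hd⟩ := hne
    exact ⟨d, hd, by simpa using hε⟩⟩
  one_mem' := ⟨fun k M hM => hM, fun D s hne hD hs u ε hε => exists_re_inner_sub_lt hne hD hs u hε⟩
  add_mem' := by
    rintro Ψ₁ Ψ₂ ⟨h1, n1⟩ ⟨h2, n2⟩
    refine ⟨fun k M hM => add_nonneg (h1 k M hM) (h2 k M hM), fun D s hne hD hs u ε hε => ?_⟩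
    obtain ⟨x, hx, hx'⟩ := n1 D s hne hD hs u (ε / 2) (half_pos hε)
    obtain ⟨y, hy, hy'⟩ := n2 D s hne hD hs u (ε / 2) (half_pos hε)
    obtain ⟨z, hz, hxz, hyz⟩ := hD x hx y hy
    refine ⟨z, hz, ?_⟩
    have e1 := (Complex.nonneg_iff.1 (nonneg_iff_inner.1 (sub_nonneg.2 (h1.mono hxz)) u)).1
    have e2 := (Complex.nonneg_iff.1 (nonneg_iff_inner.1 (sub_nonneg.2 (h2.mono hyz)) u)).1
    simp only [map_sub, sub_apply, add_apply,
      inner_sub_right, inner_add_right, Complex.sub_re, Complex.add_re] at *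
    linarith
  mul_mem' := by
    rintro Ψ₁ Ψ₂ ⟨h1, n1⟩ ⟨h2, n2⟩
    refine ⟨fun k M hM => h1 k _ (h2 k M hM), fun D s hne hD hs u ε hε => ?_⟩
    have hdir : DirectedOn (· ≤ ·) (Ψ₂ '' D) := by
      rintro _ ⟨x, hx, rfl⟩ _ ⟨y, hy, rfl⟩
      obtain ⟨z, hz, hxz, hyz⟩ := hD x hx y hy
      exact ⟨_, ⟨z, hz, rfl⟩, h2.mono hxz, h2.mono hyz⟩
    obtain ⟨_, ⟨x, hx, rfl⟩, hlt⟩ := n1 _ _ (hne.image _) hdir (n2.isNormalMap h2 D s hne hD hs)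
      u ε hε
    refine ⟨x, hx, ?_⟩
    rw [← map_sub] at hlt
    exact hlt

theorem smul_mem_normalCP {Ψ : (H →L[ℂ] H) →L[ℂ] (H →L[ℂ] H)} (h : Ψ ∈ normalCP H) {r : ℝ}
    (hr : 0 ≤ r) : (r : ℂ) • Ψ ∈ normalCP H := by
  obtain ⟨h1, n1⟩ := h
  refine ⟨fun k M hM => ?_, fun D s hne hD hs u ε hε => ?_⟩
  · have h2 : M.map ((r : ℂ) • Ψ) = (r : ℂ) • M.map Ψ := rfl
    rw [h2]
    exact smul_nonneg (by exact_mod_cast hr) (h1 k M hM)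
  · obtain ⟨x, hx, hlt⟩ := n1 D s hne hD hs u (ε / (r + 1)) (by positivity)
    refine ⟨x, hx, ?_⟩
    have e1 := (Complex.nonneg_iff.1 (nonneg_iff_inner.1
      (h1.map_nonneg (sub_nonneg.2 (hs.1 hx))) u)).1
    rw [lt_div_iff₀ (by positivity)] at hlt
    rw [smul_apply, smul_apply, inner_smul_right,
      Complex.re_ofReal_mul]
    nlinarith

theorem isClosed_normalCP :
    IsClosed (normalCP H : Set ((H →L[ℂ] H) →L[ℂ] (H →L[ℂ] H))) := by
  refine isClosed_of_closure_subset fun Ψ hΨ => ?_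
  have hcp : IsCP Ψ := closure_minimal (fun _ h => h.1) isClosed_setOf_isCP hΨ
  refine ⟨hcp, fun D s hne hD hs u ε hε => ?_⟩
  obtain ⟨d, hd⟩ := hne
  set C := ‖s - d‖ * ‖u‖ ^ 2 + 1
  have hC : 0 < C := by positivity
  obtain ⟨Θ, hΘ, hdist⟩ := Metric.mem_closure_iff.1 hΨ (ε / 2 / C) (by positivity)
  rw [dist_eq_norm] at hdist
  obtain ⟨x, hx, hlt⟩ := hΘ.2 D s ⟨d, hd⟩ hD hs u (ε / 2) (half_pos hε)
  obtain ⟨z, hz, hxz, hdz⟩ := hD x hx d hd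
  refine ⟨z, hz, ?_⟩
  have e1 := (Complex.nonneg_iff.1 (nonneg_iff_inner.1
    (sub_nonneg.2 (hΘ.1.mono hxz)) u)).1
  -- Beyond `d` the family is norm bounded, so that `Ψ` may be replaced by `Θ`.
  have e2 : ‖s - z‖ ≤ ‖s - d‖ :=
    CStarAlgebra.norm_le_norm_of_nonneg_of_le (sub_nonneg.2 (hs.1 hz)) (sub_le_sub_left hdz s)
  have e3 : (inner ℂ u ((Ψ - Θ) (s - z) u)).re < ε / 2 := by
    calc (inner ℂ u ((Ψ - Θ) (s - z) u)).re ≤ ‖inner ℂ u ((Ψ - Θ) (s - z) u)‖ :=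
          Complex.re_le_norm _
      _ ≤ ‖u‖ * ‖(Ψ - Θ) (s - z) u‖ := norm_inner_le_norm _ _
      _ ≤ ‖u‖ * (‖Ψ - Θ‖ * ‖s - d‖ * ‖u‖) := by
          refine mul_le_mul_of_nonneg_left ?_ (norm_nonneg _)
          refine (ContinuousLinearMap.le_opNorm _ _).trans ?_
          refine mul_le_mul_of_nonneg_right ?_ (norm_nonneg _)
          exact ((Ψ - Θ).le_opNorm _).trans (mul_le_mul_of_nonneg_left e2 (norm_nonneg _))
      _ = ‖Ψ - Θ‖ * (‖s - d‖ * ‖u‖ ^ 2) := by ring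
      _ ≤ ‖Ψ - Θ‖ * C := mul_le_mul_of_nonneg_left (le_add_of_nonneg_right zero_le_one)
          (norm_nonneg _)
      _ < ε / 2 / C * C := mul_lt_mul_of_pos_right hdist hC
      _ = ε / 2 := div_mul_cancel₀ _ hC.ne'
  simp only [map_sub, sub_apply, inner_sub_right, Complex.sub_re] at *
  linarith

/-- The map `x ↦ v* x v`. -/
noncomputable def conjMap (v : H →L[ℂ] H) : (H →L[ℂ] H) →L[ℂ] (H →L[ℂ] H) :=
  ContinuousLinearMap.mulLeftRight ℂ (H →L[ℂ] H) (star v) v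

theorem norm_conjMap_le (v : H →L[ℂ] H) : ‖conjMap v‖ ≤ ‖v‖ * ‖v‖ := by
  have := ContinuousLinearMap.opNorm_mulLeftRight_apply_apply_le ℂ (H →L[ℂ] H) (star v) v
  rwa [norm_star] at this

theorem conjMap_mem_normalCP {v : H →L[ℂ] H} (hv : v * star v = 1) :
    conjMap v ∈ normalCP H := by
  refine ⟨?_, fun D s hne hD hs u ε hε => ?_⟩
  · -- As `v v* = 1`, conjugation by `v` is a star homomorphism.
    let φ : (H →L[ℂ] H) →⋆ₙₐ[ℂ] (H →L[ℂ] H) :=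
      { toFun := fun x => star v * x * v
        map_smul' := fun c x => (conjMap v).map_smul c x
        map_zero' := (conjMap v).map_zero
        map_add' := (conjMap v).map_add
        map_mul' := fun x y => by
          calc star v * (x * y) * v = star v * (x * 1 * y) * v := by rw [mul_one]
            _ = _ := by rw [← hv]; simp only [mul_assoc]
        map_star' := fun x => by simp only [star_mul, star_star, mul_assoc] }
    exact fun k M hM => CompletelyPositiveMapClass.map_cstarMatrix_nonneg' φ k M hM
  · obtain ⟨x, hx, hlt⟩ := exists_re_inner_sub_lt hne hD hs (v u) hε
    refine ⟨x, hx, ?_⟩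
    have : inner ℂ u (conjMap v (s - x) u) = inner ℂ (v u) ((s - x) (v u)) :=
      ContinuousLinearMap.adjoint_inner_right v u ((s - x) (v u))
    rwa [this]

end NormalCP

/-! ### Norm continuous one-parameter semigroups -/

section Exp

variable {V : Type*} [NormedAddCommGroup V] [NormedSpace ℂ V]

theorem norm_pow_sub_pow_le {x y : V →L[ℂ] V} {K : ℝ} (hK : 1 ≤ K) (hx : ‖x‖ ≤ K) (hy : ‖y‖ ≤ K)
    (n : ℕ) : ‖x ^ n - y ^ n‖ ≤ n * K ^ n * ‖x - y‖ := by
  have hK0 : 0 ≤ K := zero_le_one.trans hK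
  have hpow : ∀ m : ℕ, ‖x ^ m‖ ≤ K ^ m := by
    intro m
    induction m with
    | zero =>
      rw [pow_zero, pow_zero]
      exact ContinuousLinearMap.norm_id_le
    | succ m ih =>
      rw [pow_succ, pow_succ]
      exact (norm_mul_le _ _).trans (mul_le_mul ih hx (norm_nonneg _) (by positivity))
  induction n with
  | zero => simp
  | succ n ih =>
    have h1 : x ^ (n + 1) - y ^ (n + 1) = x ^ n * (x - y) + (x ^ n - y ^ n) * y := by
      rw [pow_succ, pow_succ, mul_sub, sub_mul]; abel
    have h2 : K ^ n * ‖x - y‖ ≤ K ^ (n + 1) * ‖x - y‖ :=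
      mul_le_mul_of_nonneg_right (pow_le_pow_right₀ hK n.le_succ) (norm_nonneg _)
    calc ‖x ^ (n + 1) - y ^ (n + 1)‖ ≤ ‖x ^ n * (x - y)‖ + ‖(x ^ n - y ^ n) * y‖ := by
          rw [h1]; exact norm_add_le _ _
      _ ≤ K ^ n * ‖x - y‖ + n * K ^ n * ‖x - y‖ * K :=
          add_le_add ((norm_mul_le _ _).trans (mul_le_mul_of_nonneg_right (hpow n) (norm_nonneg _)))
            ((norm_mul_le _ _).trans (mul_le_mul ih hy (norm_nonneg _) (by positivity)))
      _ ≤ K ^ (n + 1) * ‖x - y‖ + n * K ^ n * ‖x - y‖ * K := by linarith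
      _ = ((n + 1 : ℕ) : ℝ) * K ^ (n + 1) * ‖x - y‖ := by push_cast; ring

theorem tendsto_coe_nhdsGT :
    Tendsto (fun t : ℝ≥0 => ((t : ℝ) : ℂ)) (𝓝[>] 0) (𝓝[≠] 0) := by
  refine tendsto_nhdsWithin_iff.2 ⟨?_, ?_⟩
  · have : Continuous fun t : ℝ≥0 => ((t : ℝ) : ℂ) := by fun_prop
    exact (this.tendsto' 0 0 (by simp)).mono_left nhdsWithin_le_nhds
  · filter_upwards [self_mem_nhdsWithin] with t ht
    have ht' : 0 < t := ht
    simpa using ht'.ne'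

/-- Two one-parameter semigroups with the same derivative at `0` coincide: `T t - S t` is the
difference of the `n`-th powers of `T (t / n)` and `S (t / n)`. -/
theorem semigroup_unique {T S : ℝ≥0 → V →L[ℂ] V} {a : V →L[ℂ] V}
    (hT0 : T 0 = 1) (hTadd : ∀ s t, T (s + t) = T s * T t)
    (hTa : Tendsto (fun t : ℝ≥0 => ((t : ℝ) : ℂ)⁻¹ • (T t - 1)) (𝓝[>] 0) (𝓝 a))
    (hS0 : S 0 = 1) (hSadd : ∀ s t, S (s + t) = S s * S t)
    (hSa : Tendsto (fun t : ℝ≥0 => ((t : ℝ) : ℂ)⁻¹ • (S t - 1)) (𝓝[>] 0) (𝓝 a)) : T = S := by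
  have hpow : ∀ U : ℝ≥0 → V →L[ℂ] V, U 0 = 1 → (∀ s t, U (s + t) = U s * U t) →
      ∀ (n : ℕ) (h : ℝ≥0), U (n * h) = U h ^ n := by
    intro U h0 hadd n h
    induction n with
    | zero => simp [h0]
    | succ n ih => rw [Nat.cast_succ, add_mul, one_mul, hadd, ih, pow_succ]
  -- This bound is multiplicative in `h`, so the powers `U (t / n) ^ k`, `k ≤ n`, stay bounded.
  have hbound : ∀ U : ℝ≥0 → V →L[ℂ] V,
      Tendsto (fun t : ℝ≥0 => ((t : ℝ) : ℂ)⁻¹ • (U t - 1)) (𝓝[>] 0) (𝓝 a) →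
      ∀ᶠ h : ℝ≥0 in 𝓝[>] 0, ‖U h‖ ≤ Real.exp ((‖a‖ + 1) * h) := by
    intro U hU
    filter_upwards [hU.norm.eventually (gt_mem_nhds (lt_add_one ‖a‖)), self_mem_nhdsWithin]
      with h hh hpos
    have hpos' : 0 < (h : ℝ) := hpos
    have h1 : ‖U h - 1‖ ≤ (‖a‖ + 1) * h := by
      rw [norm_smul, norm_inv, Complex.norm_real, Real.norm_of_nonneg hpos'.le,
        inv_mul_lt_iff₀ hpos', mul_comm] at hh
      exact hh.le
    calc ‖U h‖ = ‖(U h - 1) + 1‖ := by rw [sub_add_cancel]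
      _ ≤ (‖a‖ + 1) * h + 1 :=
          (norm_add_le _ _).trans (add_le_add h1 ContinuousLinearMap.norm_id_le)
      _ ≤ _ := Real.add_one_le_exp _
  have hdiff : Tendsto (fun h : ℝ≥0 => ‖((h : ℝ) : ℂ)⁻¹ • (T h - S h)‖) (𝓝[>] 0) (𝓝 0) := by
    have := (hTa.sub hSa).norm
    rw [sub_self, norm_zero] at this
    refine this.congr fun h => ?_
    rw [← smul_sub, sub_sub_sub_cancel_right]
  funext t
  rcases eq_or_ne t 0 with rfl | ht
  · rw [hT0, hS0]
  have htpos : 0 < t := pos_iff_ne_zero.2 ht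
  have hlim : Tendsto (fun n : ℕ => t / (n : ℝ≥0)) atTop (𝓝[>] 0) := by
    refine tendsto_nhdsWithin_iff.2 ⟨?_, ?_⟩
    · have := (tendsto_const_nhds (x := t)).mul (tendsto_inv_atTop_zero.comp
        (tendsto_natCast_atTop_atTop (R := ℝ≥0)))
      simpa [div_eq_mul_inv, Function.comp_def] using this
    · filter_upwards [eventually_gt_atTop 0] with n hn
      exact div_pos htpos (by exact_mod_cast hn)
  have hzero : Tendsto (fun n : ℕ => (t : ℝ) * Real.exp ((‖a‖ + 1) * t) *
      ‖(((t / (n : ℝ≥0) : ℝ≥0) : ℝ) : ℂ)⁻¹ • (T (t / n) - S (t / n))‖) atTop (𝓝 0) := by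
    have := (hdiff.comp hlim).const_mul ((t : ℝ) * Real.exp ((‖a‖ + 1) * t))
    rwa [mul_zero] at this
  have hle : ‖T t - S t‖ ≤ 0 := by
    refine ge_of_tendsto hzero ?_
    filter_upwards [hlim.eventually (hbound T hTa), hlim.eventually (hbound S hSa),
      eventually_gt_atTop 0] with n h1 h2 hn
    have hn' : (n : ℝ≥0) ≠ 0 := by exact_mod_cast hn.ne'
    have hn'' : (0 : ℝ) < n := by exact_mod_cast hn
    have ht' : (0 : ℝ) < t := htpos
    have e : t = n * (t / n) := by field_simp
    have hexp : Real.exp ((‖a‖ + 1) * ((t / n : ℝ≥0) : ℝ)) ^ n = Real.exp ((‖a‖ + 1) * t) := by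
      rw [← Real.exp_nat_mul]
      congr 1
      push_cast
      field_simp
    have h3 := norm_pow_sub_pow_le (Real.one_le_exp (by positivity)) h1 h2 n
    rw [hexp, ← hpow T hT0 hTadd, ← hpow S hS0 hSadd, ← e] at h3
    refine h3.trans (le_of_eq ?_)
    rw [norm_smul, norm_inv, Complex.norm_real, Real.norm_of_nonneg (NNReal.coe_nonneg _)]
    push_cast
    field_simp
  rw [← sub_eq_zero, ← norm_le_zero_iff]
  exact hle

/-- The semigroup `t ↦ exp (t a)`, where the real parameter is regarded as a complex scalar. -/
noncomputable def expSemigroup (a : V →L[ℂ] V) (t : ℝ≥0) : V →L[ℂ] V :=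
  NormedSpace.exp (((t : ℝ) : ℂ) • a)

theorem expSemigroup_zero (a : V →L[ℂ] V) : expSemigroup a 0 = 1 := by
  simp [expSemigroup, NormedSpace.exp_zero]

variable [CompleteSpace V]

theorem expSemigroup_add (a : V →L[ℂ] V) (s t : ℝ≥0) :
    expSemigroup a (s + t) = expSemigroup a s * expSemigroup a t := by
  let _ : NormedAlgebra ℚ (V →L[ℂ] V) := .restrictScalars ℚ ℂ _
  rw [expSemigroup, expSemigroup, expSemigroup, NNReal.coe_add, Complex.ofReal_add, add_smul]
  exact NormedSpace.exp_add_of_commute (((Commute.refl a).smul_left _).smul_right _)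

theorem tendsto_expSemigroup (a : V →L[ℂ] V) :
    Tendsto (fun t : ℝ≥0 => ((t : ℝ) : ℂ)⁻¹ • (expSemigroup a t - 1)) (𝓝[>] 0) (𝓝 a) := by
  have h := (hasDerivAt_exp_smul_const (𝕂 := ℂ) a (0 : ℂ)).tendsto_slope_zero
  simp only [zero_smul, NormedSpace.exp_zero, one_mul, zero_add] at h
  exact h.comp tendsto_coe_nhdsGT

theorem continuous_expSemigroup (a : V →L[ℂ] V) : Continuous (expSemigroup a) := by
  have h : Continuous fun z : ℂ => NormedSpace.exp (z • a) :=
    continuous_iff_continuousAt.2 fun z => (hasDerivAt_exp_smul_const a z).continuousAt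
  exact h.comp (by fun_prop : Continuous fun t : ℝ≥0 => ((t : ℝ) : ℂ))

theorem expSemigroup_apply_of_apply_eq_zero {a : V →L[ℂ] V} {v : V} (h : a v = 0) (t : ℝ≥0) :
    expSemigroup a t v = v := by
  have h1 := (NormedSpace.exp_series_hasSum_exp' (𝕂 := ℂ) (((t : ℝ) : ℂ) • a)).mapL
    (ContinuousLinearMap.apply ℂ V v)
  refine h1.unique ?_
  have h2 := hasSum_single (f := fun n : ℕ => ContinuousLinearMap.apply ℂ V v
    ((n.factorial⁻¹ : ℂ) • (((t : ℝ) : ℂ) • a) ^ n)) 0 (fun n hn => by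
      obtain ⟨m, rfl⟩ := Nat.exists_eq_succ_of_ne_zero hn
      rw [pow_succ, map_smul]
      change _ • ((((t : ℝ) : ℂ) • a) ^ m) (((t : ℝ) : ℂ) • a v) = 0
      rw [h, smul_zero, map_zero, smul_zero])
  simpa using h2

/-- A closed subsemiring that is stable under non-negative scalars is stable under `exp`, because
the exponential series has non-negative coefficients. -/
theorem exp_smul_mem {P : Subsemiring (V →L[ℂ] V)} (hP : IsClosed (P : Set (V →L[ℂ] V)))
    (hsmul : ∀ x ∈ P, ∀ r : ℝ, 0 ≤ r → (r : ℂ) • x ∈ P) {x : V →L[ℂ] V} (hx : x ∈ P) {t : ℝ}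
    (ht : 0 ≤ t) : NormedSpace.exp ((t : ℂ) • x) ∈ P := by
  refine hP.mem_of_tendsto (NormedSpace.exp_series_hasSum_exp' (𝕂 := ℂ) ((t : ℂ) • x))
    (Eventually.of_forall fun F => sum_mem fun n _ => ?_)
  have := hsmul _ (pow_mem (hsmul x hx t ht) n) ((n.factorial : ℝ)⁻¹) (by positivity)
  push_cast at this
  exact this

theorem expSemigroup_sub_one (a : V →L[ℂ] V) (t : ℝ≥0) :
    expSemigroup (a - 1) t = (Real.exp (-t) : ℂ) • NormedSpace.exp (((t : ℝ) : ℂ) • a) := by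
  let _ : NormedAlgebra ℚ (V →L[ℂ] V) := .restrictScalars ℚ ℂ _
  have h1 : ((t : ℝ) : ℂ) • (a - 1) = algebraMap ℂ (V →L[ℂ] V) (-(t : ℝ) : ℂ) +
      ((t : ℝ) : ℂ) • a := by
    rw [Algebra.algebraMap_eq_smul_one, smul_sub, neg_smul]; abel
  rw [expSemigroup, h1, NormedSpace.exp_add_of_commute (Algebra.commutes _ _),
    ← NormedSpace.algebraMap_exp_comm, Algebra.algebraMap_eq_smul_one, smul_mul_assoc, one_mul,
    ← Complex.exp_eq_exp_ℂ, Complex.ofReal_exp, Complex.ofReal_neg]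

end Exp

/-! ### Quantum Markov semigroups and their generators -/

section Generator

variable {H : Type*} [NormedAddCommGroup H] [InnerProductSpace ℂ H]

theorem IsGenerator.tendsto_apply {T : ℝ≥0 → (H →L[ℂ] H) →L[ℂ] (H →L[ℂ] H)}
    {𝓛 : (H →L[ℂ] H) →L[ℂ] (H →L[ℂ] H)} (h : IsGenerator T 𝓛) (x : H →L[ℂ] H) :
    Tendsto (fun t : ℝ≥0 => ((t : ℝ) : ℂ)⁻¹ • (T t x - x)) (𝓝[>] 0) (𝓝 (𝓛 x)) :=
  ((ContinuousLinearMap.apply ℂ (H →L[ℂ] H) x).continuous.tendsto 𝓛).comp h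

variable [CompleteSpace H]


theorem expSemigroup_sub_one_mem_normalCP {Φ : (H →L[ℂ] H) →L[ℂ] (H →L[ℂ] H)}
    (h : Φ ∈ normalCP H) (t : ℝ≥0) : expSemigroup (Φ - 1) t ∈ normalCP H := by
  have h1 : NormedSpace.exp (((t : ℝ) : ℂ) • Φ) ∈ normalCP H := by
    refine exp_smul_mem (P := normalCP H) isClosed_normalCP ?_ ?_ t.coe_nonneg
    · exact fun x hx r hr => smul_mem_normalCP hx hr
    · exact h
  rw [expSemigroup_sub_one]
  exact smul_mem_normalCP h1 (Real.exp_pos _).le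

/-- The semigroup `exp (t (Φ - 1)) = exp (-t) exp (t Φ)` inherits normality and complete positivity
from `Φ`. -/
theorem isUniformlyContinuousQMS_expSemigroup {Φ : (H →L[ℂ] H) →L[ℂ] (H →L[ℂ] H)}
    (h : Φ ∈ normalCP H) (h1 : Φ 1 = 1) : IsUniformlyContinuousQMS (expSemigroup (Φ - 1)) := by
  have hmem := expSemigroup_sub_one_mem_normalCP h
  have h0 : (Φ - 1) 1 = 0 := by rw [sub_apply, h1, one_apply_eq_self, sub_self]
  have hcont : Tendsto (expSemigroup (Φ - 1)) (𝓝[>] 0) (𝓝 (expSemigroup (Φ - 1) 0)) :=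
    ((continuous_expSemigroup (Φ - 1)).tendsto 0).mono_left nhdsWithin_le_nhds
  rw [expSemigroup_zero] at hcont
  refine ⟨expSemigroup_zero _, expSemigroup_add _, ?_, ?_, ?_, hcont⟩
  · intro t
    exact (hmem t).1.exists_completelyPositiveMap
  · intro t
    exact expSemigroup_apply_of_apply_eq_zero h0 t
  · intro t
    exact (hmem t).2.isNormalMap (hmem t).1

theorem IsGenerator.eq_expSemigroup {T : ℝ≥0 → (H →L[ℂ] H) →L[ℂ] (H →L[ℂ] H)}
    {𝓛 : (H →L[ℂ] H) →L[ℂ] (H →L[ℂ] H)} (h : IsGenerator T 𝓛) (hT : IsUniformlyContinuousQMS T) :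
    T = expSemigroup 𝓛 :=
  semigroup_unique hT.zero hT.add h (expSemigroup_zero _) (expSemigroup_add _)
    (tendsto_expSemigroup _)

/-- On the decoherence-free subalgebra the generator satisfies the Leibniz rule for `x* x`. -/
theorem IsGenerator.leibniz {T : ℝ≥0 → (H →L[ℂ] H) →L[ℂ] (H →L[ℂ] H)}
    {𝓛 : (H →L[ℂ] H) →L[ℂ] (H →L[ℂ] H)} (h : IsGenerator T 𝓛) (hT : IsUniformlyContinuousQMS T)
    {x : H →L[ℂ] H} (hx : x ∈ decoherenceFree T) :
    𝓛 (star x * x) = star (𝓛 x) * x + star x * 𝓛 x := by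
  refine tendsto_nhds_unique (h.tendsto_apply (star x * x)) ?_
  have hTx : Tendsto (fun t => T t x) (𝓝[>] 0) (𝓝 x) :=
    ((ContinuousLinearMap.apply ℂ (H →L[ℂ] H) x).continuous.tendsto _).comp hT.uniformlyContinuous
  refine (((h.tendsto_apply x).star.mul hTx).add
    ((h.tendsto_apply x).const_mul (star x))).congr fun t => ?_
  rw [(hx t).1, star_smul, Complex.star_def, map_inv₀, Complex.conj_ofReal, star_sub,
    smul_mul_assoc, mul_smul_comm, ← smul_add]
  congr 1
  rw [sub_mul, mul_sub]
  abel

/-- A vanishing sum of positive operators has vanishing terms. -/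
theorem eq_zero_of_hasSum_zero {ι : Type*} {r : ι → ℝ} (hr : ∀ i, 0 ≤ r i) {b : ι → H →L[ℂ] H}
    (h : HasSum (fun i => (r i : ℂ) • (star (b i) * b i)) 0) {i : ι} (hi : r i ≠ 0) : b i = 0 := by
  have hnonneg : ∀ j, 0 ≤ (r j : ℂ) • (star (b j) * b j) := fun j =>
    smul_nonneg (by exact_mod_cast hr j) (star_mul_self_nonneg _)
  have h1 := le_antisymm (le_hasSum h i fun j _ => hnonneg j) (hnonneg i)
  have hi' : (r i : ℂ) ≠ 0 := by exact_mod_cast hi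
  exact (CStarRing.star_mul_self_eq_zero_iff _).1 ((smul_eq_zero.1 h1).resolve_left hi')

end Generator

/-! ### The semigroup generated by averaged translations -/

section Average

variable {G : Type*} [Group G]

theorem norm_leftOp_le (g : G) : ‖leftOp g‖ ≤ 1 :=
  ContinuousLinearMap.opNorm_le_bound _ zero_le_one fun u => by
    rw [leftOp, norm_permOp_apply, one_mul]

theorem summable_smul_conjMap {c : G → ℝ} (h0 : ∀ g, 0 ≤ c g) (hc : Summable c) :
    Summable fun g => (c g : ℂ) • conjMap (leftOp g) := by
  refine Summable.of_norm_bounded hc fun g => ?_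
  rw [norm_smul, Complex.norm_real, Real.norm_of_nonneg (h0 g)]
  refine mul_le_of_le_one_right (h0 g) ((norm_conjMap_le _).trans ?_)
  exact mul_le_one₀ (norm_leftOp_le g) (norm_nonneg _) (norm_leftOp_le g)

/-- The average `x ↦ ∑ c_g L_g* x L_g` of the conjugations by left translations. -/
noncomputable def averageMap (c : G → ℝ) :
    (ell2 G →L[ℂ] ell2 G) →L[ℂ] (ell2 G →L[ℂ] ell2 G) :=
  ∑' g, (c g : ℂ) • conjMap (leftOp g)

theorem hasSum_averageMap_apply {c : G → ℝ} (h0 : ∀ g, 0 ≤ c g) (hc : Summable c)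
    (x : ell2 G →L[ℂ] ell2 G) :
    HasSum (fun g => (c g : ℂ) • (star (leftOp g) * x * leftOp g)) (averageMap c x) :=
  (summable_smul_conjMap h0 hc).hasSum.mapL (ContinuousLinearMap.apply ℂ _ x)

theorem averageMap_mem_normalCP {c : G → ℝ} (h0 : ∀ g, 0 ≤ c g) (hc : Summable c) :
    averageMap c ∈ normalCP (ell2 G) :=
  isClosed_normalCP.mem_of_tendsto (summable_smul_conjMap h0 hc).hasSum
    (Eventually.of_forall fun _ => sum_mem fun g _ =>
      smul_mem_normalCP (conjMap_mem_normalCP (leftOp_mul_star_self g)) (h0 g))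

theorem averageMap_apply_of_commute {c : G → ℝ} (h0 : ∀ g, 0 ≤ c g) (hc : HasSum c 1)
    {x : ell2 G →L[ℂ] ell2 G} (hx : x ∈ Set.centralizer (Set.range leftOp)) :
    averageMap c x = x := by
  refine (hasSum_averageMap_apply h0 hc.summable x).unique ?_
  have h1 : ∀ g, star (leftOp g) * x * leftOp g = x := fun g => by
    rw [mul_assoc, ← hx _ ⟨g, rfl⟩, ← mul_assoc, star_leftOp_mul_self, one_mul]
  simp only [h1]
  have h2 := (Complex.hasSum_ofReal.2 hc).smul_const x
  simpa using h2

theorem averageMap_sub_one_apply_of_commute {c : G → ℝ} (h0 : ∀ g, 0 ≤ c g) (hc : HasSum c 1)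
    {x : ell2 G →L[ℂ] ell2 G} (hx : x ∈ Set.centralizer (Set.range leftOp)) :
    (averageMap c - 1) x = 0 := by
  rw [sub_apply, averageMap_apply_of_commute h0 hc hx, one_apply_eq_self, sub_self]

theorem one_mem_centralizer_leftOp :
    (1 : ell2 G →L[ℂ] ell2 G) ∈ Set.centralizer (Set.range leftOp) :=
  fun y _ => by rw [mul_one, one_mul]

theorem star_mem_centralizer_leftOp {x : ell2 G →L[ℂ] ell2 G}
    (hx : x ∈ Set.centralizer (Set.range leftOp)) :
    star x ∈ Set.centralizer (Set.range leftOp) := by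
  rw [← mem_rightGroupVN] at hx ⊢
  exact star_mem hx

theorem isGKSL_averageMap {c : G → ℝ} (h0 : ∀ g, 0 ≤ c g) (hc : HasSum c 1) :
    IsGKSL (averageMap c - 1) 0 (fun g => ((Real.sqrt (c g) : ℝ) : ℂ) • leftOp g) := by
  have hsq : ∀ g, ((Real.sqrt (c g) : ℝ) : ℂ) * ((Real.sqrt (c g) : ℝ) : ℂ) = (c g : ℂ) :=
      fun g => by
    rw [← Complex.ofReal_mul, Real.mul_self_sqrt (h0 g)]
  have hV : ∀ g, star (((Real.sqrt (c g) : ℝ) : ℂ) • leftOp g) =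
      ((Real.sqrt (c g) : ℝ) : ℂ) • star (leftOp g) := fun g => by
    rw [star_smul, Complex.star_def, Complex.conj_ofReal]
  have hVV : ∀ g, star (((Real.sqrt (c g) : ℝ) : ℂ) • leftOp g) *
      (((Real.sqrt (c g) : ℝ) : ℂ) • leftOp g) = (c g : ℂ) • 1 := fun g => by
    rw [hV, smul_mul_smul_comm, hsq, star_leftOp_mul_self]
  refine ⟨IsSelfAdjoint.zero _, ⟨1, fun u => ?_⟩, fun x u => ?_⟩
  · simp only [hVV]
    have h1 := (Complex.hasSum_ofReal.2 hc).smul_const u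
    rw [Complex.ofReal_one, one_smul] at h1
    exact h1
  · have h1 := ((hasSum_averageMap_apply h0 hc.summable x).sub
      ((Complex.hasSum_ofReal.2 hc).smul_const x)).mapL
        (ContinuousLinearMap.apply ℂ (ell2 G) u)
    have h2 : (averageMap c - 1) x - Complex.I • (0 * x - x * 0) =
        averageMap c x - ((1 : ℝ) : ℂ) • x := by
      rw [sub_apply, one_apply_eq_self, zero_mul, mul_zero, sub_zero, smul_zero, sub_zero,
        Complex.ofReal_one, one_smul]
    rw [h2]
    refine h1.congr_fun fun g => ?_
    have h3 : star (((Real.sqrt (c g) : ℝ) : ℂ) • leftOp g) * x *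
        (((Real.sqrt (c g) : ℝ) : ℂ) • leftOp g) =
        (c g : ℂ) • (star (leftOp g) * x * leftOp g) := by
      rw [hV, smul_mul_assoc, smul_mul_smul_comm, hsq]
    rw [hVV, mul_assoc x, hVV, h3, smul_mul_assoc, mul_smul_comm, one_mul, mul_one,
      ContinuousLinearMap.apply_apply]
    simp only [sub_apply, add_apply, smul_apply]
    module

/-- If `x` commutes with the translations in a generating set, it commutes with all of them. -/
theorem mem_centralizer_leftOp_of_closure {S : Set G} (hS : Subgroup.closure S = ⊤)
    {x : ell2 G →L[ℂ] ell2 G} (hx : ∀ g ∈ S, x * leftOp g = leftOp g * x) :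
    x ∈ Set.centralizer (Set.range leftOp) := by
  rintro _ ⟨g, rfl⟩
  have hg : g ∈ Subgroup.closure S := hS ▸ Subgroup.mem_top g
  induction hg using Subgroup.closure_induction with
  | mem g hg => exact (hx g hg).symm
  | one => rw [leftOp_one, one_mul, mul_one]
  | mul g h _ _ hg hh => rw [leftOp_mul, mul_assoc, hh, ← mul_assoc, hg, mul_assoc]
  | inv g _ hg =>
    calc leftOp g⁻¹ * x = leftOp g⁻¹ * (x * leftOp g) * leftOp g⁻¹ := by
          rw [mul_assoc, mul_assoc, ← leftOp_mul, mul_inv_cancel, leftOp_one, mul_one]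
      _ = x * leftOp g⁻¹ := by
          rw [← hg, ← mul_assoc, ← leftOp_mul, inv_mul_cancel, leftOp_one, one_mul]

/-- The dissipation form of `𝓛 = Φ - 1` is the sum of the positive operators
`c_g [x, L_g]* [x, L_g]`. -/
theorem hasSum_dissipation {c : G → ℝ} (h0 : ∀ g, 0 ≤ c g) (hc : HasSum c 1)
    (x : ell2 G →L[ℂ] ell2 G) :
    HasSum (fun g => (c g : ℂ) • (star (x * leftOp g - leftOp g * x) *
        (x * leftOp g - leftOp g * x)))
      ((averageMap c - 1) (star x * x) -
        (star ((averageMap c - 1) x) * x + star x * (averageMap c - 1) x)) := by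
  have hs := hasSum_averageMap_apply h0 hc.summable
  have h1 := hs (star x * x)
  have h2 := (hs x).star.mul_right x
  have h3 := (hs x).mul_left (star x)
  have h4 := (Complex.hasSum_ofReal.2 hc).smul_const (star x * x)
  have e0 : (averageMap c - 1) (star x * x) -
      (star ((averageMap c - 1) x) * x + star x * (averageMap c - 1) x) =
      averageMap c (star x * x) - star (averageMap c x) * x - star x * averageMap c x +
        ((1 : ℝ) : ℂ) • (star x * x) := by
    rw [sub_apply, sub_apply, one_apply_eq_self, one_apply_eq_self, star_sub, sub_mul, mul_sub,
      Complex.ofReal_one, one_smul]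
    abel
  rw [e0]
  refine (((h1.sub h2).sub h3).add h4).congr_fun fun g => ?_
  have e1 : star (leftOp g) * leftOp g = 1 := star_leftOp_mul_self g
  have e2 : star (x * leftOp g - leftOp g * x) * (x * leftOp g - leftOp g * x) =
      star (leftOp g) * (star x * x) * leftOp g - star (star (leftOp g) * x * leftOp g) * x -
        star x * (star (leftOp g) * x * leftOp g) + star x * x := by
    have e3 : star x * star (leftOp g) * (leftOp g * x) = star x * x := by
      rw [mul_assoc, ← mul_assoc (star (leftOp g)), e1, one_mul]
    simp only [star_sub, star_mul, star_star, sub_mul, mul_sub, e3]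
    simp only [mul_assoc]
    abel
  rw [e2, star_smul, Complex.star_def, Complex.conj_ofReal, smul_mul_assoc, mul_smul_comm]
  module

/-- The decoherence-free subalgebra is the commutant of the translations. By the Leibniz rule the
dissipation form vanishes on it, hence so do the commutators `[x, L_g]` with `c_g ≠ 0`. Conversely,
operators commuting with all translations are fixed by the semigroup. -/
theorem decoherenceFree_eq_centralizer {c : G → ℝ} (h0 : ∀ g, 0 ≤ c g) (hc : HasSum c 1)
    (hgen : Subgroup.closure {g | c g ≠ 0} = ⊤)
    {T : ℝ≥0 → (ell2 G →L[ℂ] ell2 G) →L[ℂ] (ell2 G →L[ℂ] ell2 G)}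
    (hT : IsUniformlyContinuousQMS T) (hL : IsGenerator T (averageMap c - 1)) :
    decoherenceFree T = Set.centralizer (Set.range leftOp) := by
  refine Set.Subset.antisymm (fun x hx => ?_) fun x hx t => ?_
  · refine mem_centralizer_leftOp_of_closure hgen fun g hg => ?_
    have hsum := hasSum_dissipation h0 hc x
    rw [hL.leibniz hT hx, sub_self] at hsum
    exact sub_eq_zero.1 (eq_zero_of_hasSum_zero h0 hsum hg)
  · have hfix : ∀ y ∈ Set.centralizer (Set.range (leftOp (G := G))), T t y = y := fun y hy => by
      rw [hL.eq_expSemigroup hT]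
      exact expSemigroup_apply_of_apply_eq_zero (averageMap_sub_one_apply_of_commute h0 hc hy) t
    have hs := star_mem_centralizer_leftOp hx
    rw [hfix x hx, hfix _ (Set.mul_mem_centralizer hs hx), hfix _ (Set.mul_mem_centralizer hx hs)]
    exact ⟨rfl, rfl⟩

end Average

/-! ### Invariant states -/

section InvariantState

variable {G : Type*} [Group G]

/-- A summable non-negative function on an infinite group that is harmonic for a generating
probability measure vanishes: it attains its maximum on a finite set, which is invariant under the
whole group. -/
theorem eq_zero_of_harmonic [Infinite G] {c f : G → ℝ} (h0 : ∀ g, 0 ≤ c g) (hc : HasSum c 1)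
    (hgen : Subgroup.closure {g | c g ≠ 0} = ⊤) (hf0 : ∀ h, 0 ≤ f h) (hf : Summable f)
    (hharm : ∀ h, HasSum (fun g => c g * f (g⁻¹ * h)) (f h)) (a : G) : f a = 0 := by
  by_contra hne
  have hpos : 0 < f a := lt_of_le_of_ne (hf0 a) (Ne.symm hne)
  have hfin : ∀ r, 0 < r → {h | r ≤ f h}.Finite := fun r hr => by
    have := hf.tendsto_cofinite_zero.eventually (gt_mem_nhds hr)
    refine Set.Finite.subset this fun h hh => ?_
    simpa using hh
  obtain ⟨b, hb, hmax⟩ := (hfin (f a) hpos).exists_maximalFor f _ ⟨a, le_refl (f a)⟩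
  have hle : ∀ h, f h ≤ f b := fun h => by
    rcases le_total (f a) (f h) with hh | hh
    · by_contra hlt
      exact hlt (hmax hh (le_of_not_ge hlt))
    · exact hh.trans hb
  set S : Set G := {h | f h = f b}
  have hSfin : S.Finite := (hfin (f b) (hpos.trans_le hb)).subset fun h hh => (Eq.ge hh : f b ≤ f h)
  -- A weighted average of values at most `f b` equals `f b` only if all of them do.
  have hstep : ∀ g, c g ≠ 0 → ∀ h ∈ S, g⁻¹ * h ∈ S := by
    intro g hg h hh
    have h1 := (hc.mul_right (f b)).sub (hharm h)
    rw [one_mul, (hh : f h = f b), sub_self] at h1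
    have hn : ∀ g, 0 ≤ c g * f b - c g * f (g⁻¹ * h) := fun g => by
      rw [← mul_sub]; exact mul_nonneg (h0 g) (sub_nonneg.2 (hle _))
    have h2 := congrFun ((hasSum_zero_iff_of_nonneg hn).1 h1) g
    rw [Pi.zero_apply, ← mul_sub] at h2
    exact (sub_eq_zero.1 ((mul_eq_zero.1 h2).resolve_left hg)).symm
  -- An injective self-map of the finite set `S` is onto, so `S` is invariant under inverses too.
  have hinv : ∀ g, c g ≠ 0 → ∀ h, g⁻¹ * h ∈ S ↔ h ∈ S := by
    intro g hg h
    refine ⟨fun hh => ?_, hstep g hg h⟩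
    obtain ⟨k, hk, hk'⟩ := ((hSfin.injOn_iff_bijOn_of_mapsTo (f := fun h => g⁻¹ * h)
      (fun k hk => hstep g hg k hk)).1 (mul_right_injective g⁻¹).injOn).surjOn hh
    rwa [← mul_left_cancel hk']
  have hall : ∀ g h : G, g⁻¹ * h ∈ S ↔ h ∈ S := by
    intro g
    have hg : g ∈ Subgroup.closure {g | c g ≠ 0} := hgen ▸ Subgroup.mem_top g
    induction hg using Subgroup.closure_induction with
    | mem g hg => exact hinv g hg
    | one => simp
    | mul g k _ _ hg hk => intro h; rw [mul_inv_rev, mul_assoc, hk, hg]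
    | inv g _ hg => intro h; rw [← hg, inv_inv, inv_mul_cancel_left]
  refine Set.infinite_univ (α := G) (hSfin.subset fun h _ => ?_)
  have := hall (b * h⁻¹) b
  rw [mul_inv_rev, inv_inv, mul_assoc, inv_mul_cancel, mul_one] at this
  exact this.2 rfl

/-- Positive functionals are bounded. -/
theorem continuous_of_nonneg {H : Type*} [NormedAddCommGroup H] [InnerProductSpace ℂ H]
    [CompleteSpace H] {φ : (H →L[ℂ] H) →ₗ[ℂ] ℂ} (h : ∀ x, 0 ≤ x → 0 ≤ φ x) : Continuous φ := by
  let ψ : (H →L[ℂ] H) →ₚ[ℂ] ℂ := PositiveLinearMap.mk₀ φ h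
  obtain ⟨C, hC⟩ := ψ.exists_norm_apply_le
  exact AddMonoidHomClass.continuous_of_bound φ C hC

end InvariantState

section DeltaProj

variable {G : Type*} [DecidableEq G]

/-- The projection onto the line spanned by `δ_g`. -/
noncomputable def deltaProj (g : G) : ell2 G →L[ℂ] ell2 G :=
  InnerProductSpace.rankOne ℂ (delta g) (delta g)

theorem deltaProj_apply (g : G) (u : ell2 G) : deltaProj g u = u g • delta g := by
  rw [deltaProj, InnerProductSpace.rankOne_apply, inner_delta_left]

theorem inner_deltaProj (g : G) (u : ell2 G) :
    inner ℂ u (deltaProj g u) = ((‖u g‖ ^ 2 : ℝ) : ℂ) := by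
  rw [deltaProj_apply, inner_smul_right, ← inner_conj_symm, inner_delta_left, Complex.mul_conj']
  push_cast
  rfl

theorem deltaProj_nonneg (g : G) : 0 ≤ deltaProj g :=
  nonneg_iff_inner.2 fun u => by
    rw [inner_deltaProj]
    exact Complex.zero_le_real.2 (sq_nonneg _)

theorem deltaProj_ne_zero (g : G) : deltaProj g ≠ 0 := fun h => by
  have := congrArg (fun z : ell2 G →L[ℂ] ell2 G => z (delta g) g) h
  simp [deltaProj_apply, delta_apply] at this

theorem sum_deltaProj_le_one (F : Finset G) : ∑ g ∈ F, deltaProj g ≤ 1 := by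
  rw [← sub_nonneg, nonneg_iff_inner]
  intro u
  have h1 : inner ℂ u u = ((‖u‖ ^ 2 : ℝ) : ℂ) := by
    rw [inner_self_eq_norm_sq_to_K]; push_cast; rfl
  rw [sub_apply, inner_sub_right, sum_apply, inner_sum, sub_nonneg,
    Finset.sum_congr rfl fun g _ => inner_deltaProj g u, one_apply_eq_self, h1,
    ← Complex.ofReal_sum]
  exact Complex.real_le_real.2 (sum_le_hasSum F (fun g _ => sq_nonneg ‖u g‖) (hasSum_norm_sq u))

variable [Group G]

theorem conj_deltaProj (g h : G) :
    star (leftOp g) * deltaProj h * leftOp g = deltaProj (g⁻¹ * h) := by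
  ext u : 1
  change star (leftOp g) (deltaProj h (leftOp g u)) = _
  rw [deltaProj_apply, deltaProj_apply, map_smul, star_leftOp, leftOp_delta]
  rfl

/-- There is no faithful invariant state: the diagonal `h ↦ φ(e_h)` of such a state would be a
non-zero summable harmonic function on `G`. -/
theorem not_exists_invariant_state [Infinite G] {c : G → ℝ} (h0 : ∀ g, 0 ≤ c g) (hc : HasSum c 1)
    (hgen : Subgroup.closure {g | c g ≠ 0} = ⊤)
    {T : ℝ≥0 → (ell2 G →L[ℂ] ell2 G) →L[ℂ] (ell2 G →L[ℂ] ell2 G)}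
    (hL : IsGenerator T (averageMap c - 1)) :
    ¬ ∃ φ : (ell2 G →L[ℂ] ell2 G) →ₗ[ℂ] ℂ, IsFaithfulNormalState φ ∧ IsInvariant T φ := by
  rintro ⟨φ, hφ, hinv⟩
  have hcont := continuous_of_nonneg hφ.nonneg
  have hΦ : ∀ x, φ (averageMap c x) = φ x := fun x => by
    have h1 := (hcont.tendsto _).comp (hL.tendsto_apply x)
    have h2 : φ ∘ (fun t : ℝ≥0 => ((t : ℝ) : ℂ)⁻¹ • (T t x - x)) = fun _ => 0 := by
      funext t
      rw [Function.comp_apply, map_smul, map_sub, hinv t x, sub_self, smul_zero]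
    rw [h2] at h1
    have h3 := tendsto_nhds_unique h1 tendsto_const_nhds
    rw [sub_apply, map_sub] at h3
    exact sub_eq_zero.1 h3
  let f : G → ℝ := fun h => (φ (deltaProj h)).re
  have hf0 : ∀ h, 0 ≤ f h := fun h => (Complex.nonneg_iff.1 (hφ.nonneg _ (deltaProj_nonneg h))).1
  have hfφ : ∀ h, φ (deltaProj h) = f h := fun h =>
    (Complex.eq_re_of_ofReal_le (hφ.nonneg _ (deltaProj_nonneg h)))
  have hf : Summable f := summable_of_sum_le hf0 (c := 1) fun F => by
    have h1 := hφ.nonneg _ (sub_nonneg.2 (sum_deltaProj_le_one F))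
    rw [map_sub, hφ.map_one, map_sum] at h1
    have h2 := (Complex.nonneg_iff.1 h1).1
    rw [Complex.sub_re, Complex.re_sum, Complex.one_re, sub_nonneg] at h2
    exact h2
  have hharm : ∀ h, HasSum (fun g => c g * f (g⁻¹ * h)) (f h) := fun h => by
    have h1 := ((hasSum_averageMap_apply h0 hc.summable (deltaProj h)).map φ hcont)
    rw [hΦ, hfφ] at h1
    refine Complex.hasSum_ofReal.1 (h1.congr_fun fun g => ?_)
    rw [Function.comp_apply, map_smul, conj_deltaProj, hfφ, Complex.ofReal_mul, smul_eq_mul]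
  have h1 := eq_zero_of_harmonic h0 hc hgen hf0 hf hharm 1
  refine deltaProj_ne_zero (1 : G) (hφ.faithful _ (deltaProj_nonneg 1) ?_)
  rw [hfφ, h1, Complex.ofReal_zero]

end DeltaProj

/-! ### Strictly positive weights and the free group -/

theorem exists_pos_hasSum_one (ι : Type*) [Countable ι] [Nonempty ι] :
    ∃ c : ι → ℝ, (∀ i, 0 < c i) ∧ HasSum c 1 := by
  have := Encodable.ofCountable ι
  obtain ⟨w, hw, r, hr, -⟩ := posSumOfEncodable one_pos ι
  obtain ⟨i⟩ := ‹Nonempty ι›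
  have hr0 : 0 < r := (hw i).trans_le (le_hasSum hr i fun j _ => (hw j).le)
  refine ⟨fun i => w i / r, fun i => div_pos (hw i) hr0, ?_⟩
  have := hr.div_const r
  rwa [div_self hr0.ne'] at this

end QMS

open QMS in
theorem mainTheorem11 (n : ℕ) (hn : 2 ≤ n) :
    (∃ c : FreeGroup (Fin n) → ℝ, (∀ g, 0 < c g) ∧ HasSum c 1) ∧
    ∀ c : FreeGroup (Fin n) → ℝ, (∀ g, 0 ≤ c g) → HasSum c 1 →
      Subgroup.closure {g | c g ≠ 0} = ⊤ →
      ∃ 𝓛 : (ell2 (FreeGroup (Fin n)) →L[ℂ] ell2 (FreeGroup (Fin n))) →L[ℂ]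
          (ell2 (FreeGroup (Fin n)) →L[ℂ] ell2 (FreeGroup (Fin n))),
        (∀ x, (Summable fun g => (c g : ℂ) • (star (leftOp g) * x * leftOp g)) ∧
          𝓛 x = (∑' g, (c g : ℂ) • (star (leftOp g) * x * leftOp g)) - x) ∧
        IsGKSL 𝓛 0 (fun g => ((Real.sqrt (c g) : ℝ) : ℂ) • leftOp g) ∧
        (∃! T : ℝ≥0 → (ell2 (FreeGroup (Fin n)) →L[ℂ] ell2 (FreeGroup (Fin n))) →L[ℂ]
            (ell2 (FreeGroup (Fin n)) →L[ℂ] ell2 (FreeGroup (Fin n))),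
          IsUniformlyContinuousQMS T ∧ IsGenerator T 𝓛) ∧
        ∀ T : ℝ≥0 → (ell2 (FreeGroup (Fin n)) →L[ℂ] ell2 (FreeGroup (Fin n))) →L[ℂ]
            (ell2 (FreeGroup (Fin n)) →L[ℂ] ell2 (FreeGroup (Fin n))),
          IsUniformlyContinuousQMS T → IsGenerator T 𝓛 →
            decoherenceFree T = Set.centralizer (Set.range leftOp) ∧
            decoherenceFree T = (leftGroupVN (FreeGroup (Fin n))).commutant ∧
            decoherenceFree T = rightGroupVN (FreeGroup (Fin n)) ∧
            IsTypeII₁Factor (rightGroupVN (FreeGroup (Fin n))) ∧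
            ¬ IsAtomic (rightGroupVN (FreeGroup (Fin n))) ∧
            ¬ ∃ φ : (ell2 (FreeGroup (Fin n)) →L[ℂ] ell2 (FreeGroup (Fin n))) →ₗ[ℂ] ℂ,
              IsFaithfulNormalState φ ∧ IsInvariant T φ := by
  have : Nontrivial (Fin n) := Fin.nontrivial_iff_two_le.2 hn
  have : Nonempty (Fin n) := inferInstance
  have : Countable (FreeGroup (Fin n)) := FreeGroup.toWord_injective.countable
  refine ⟨exists_pos_hasSum_one _, fun c h0 hc hgen => ?_⟩
  refine ⟨averageMap c - 1, fun x => ?_, isGKSL_averageMap h0 hc, ?_, fun T hT hL => ?_⟩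
  · have hs := hasSum_averageMap_apply h0 hc.summable x
    refine ⟨hs.summable, ?_⟩
    rw [hs.tsum_eq]
    rfl
  · exact ⟨expSemigroup (averageMap c - 1),
      ⟨isUniformlyContinuousQMS_expSemigroup (averageMap_mem_normalCP h0 hc.summable)
        (averageMap_apply_of_commute h0 hc one_mem_centralizer_leftOp), tendsto_expSemigroup _⟩,
      fun T hT => hT.2.eq_expSemigroup hT.1⟩
  · have hN := decoherenceFree_eq_centralizer h0 hc hgen hT hL
    exact ⟨hN, hN.trans coe_commutant_leftGroupVN.symm, hN.trans coe_rightGroupVN.symm,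
      isTypeII₁Factor_rightGroupVN fun a ha => freeGroup_infinite_conj ha,
      not_isAtomic_rightGroupVN, not_exists_invariant_state h0 hc hgen hL⟩
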